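/- Let $M$ be a continuous-time irreducible Markov chain with a non-empty finite state space $V$ and transition rates $q_{ij}$ such that $q_{ij}>0$ if and only if $q_{ji}>0$ ($i\neq j$). Let $G=(V,E)$ be its graph, where $i\ne j$ are adjacent if and only if $q_{ij}>0$, let $|G|$ be the geometric realization of $G$, and let $n=|E|-|V|+1$ be the first Betti number. The potential gain of a trajectory (walk in $G$) $i_1,\dots,i_k$ is $\sum_{j=1}^{k-1}\log\frac{q_{i_{j+1}i_j}}{q_{i_ji_{j+1}}}$; it is understood symbolically, i.e. as a function of the rates, and is called zero if it vanishes for all Markov chains (of the above kind) with the same graph $G$. Let $\mathbb T^n=(\mathbb R/\mathbb Z)^n$. A closed curve in $\mathbb T^n$ is homotopy trivial if it can be continuously deformed, through closed curves, into a single point. For every spanning tree of $G$ there are exactly $n$ edges outside it (and a spanning tree exists). For every choice of a spanning tree, of an enumeration $e_1,\dots,e_n$ of the edges outside it, and of orientations of these edges, there is a continuous map $f:|G|\to\mathbb T^n$ such that: 1. a closed trajectory of $M$ has zero potential gain if and only if its image under $f$ is homotopy trivial in $\mathbb T^n$; 2. for each $i$, the $i$-th independent cycle ($e_i$ followed by the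 path in the tree back to its starting point) is sent to a loop that is homotopic, with fixed base point, to the loop running once around the $i$-th circle factor and constant in the other factors; 3. $f$ is a topological embedding if $n\ge 3$, and also if $n=2$ and $G$ does not contain two vertex-disjoint cycles. If $n=2$, then in any case $f$ is an embedding up to finitely many crossings of edges: no other point has the same image as a vertex, $f$ is injective on each edge, and only finitely many pairs of distinct points of $|G|$ have the same image. If $n=1$, then $f$ restricted to the cycle of $G$ is an embedding. Moreover, if $n=1$ and $|G|$ can be topologically embedded into $\mathbb T^1$, then every vertex of $G$ has degree $2$, that is, $G$ is a cycle. -/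

import Mathlib

open scoped unitInterval

/-- A continuous-time irreducible Markov chain on the finite state space `V`, given by its
transition rate matrix: `rate i j` is the rate of jumping from `i` to `j` for `i ≠ j`.
A transition is possible if and only if the reverse transition is possible. -/
structure MarkovChain (V : Type*) [Fintype V] where
  rate : Matrix V V ℝ
  rate_nonneg : ∀ i j, i ≠ j → 0 ≤ rate i j
  row_sum : ∀ i, ∑ j, rate i j = 0
  rate_pos_iff : ∀ i j, i ≠ j → (0 < rate i j ↔ 0 < rate j i)
  irreducible : ∀ i j, Relation.ReflTransGen (fun a b => a ≠ b ∧ 0 < rate a b) i j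

/-- The graph of a Markov chain: vertices are the states, edges the possible transitions. -/
def MarkovChain.graph {V : Type*} [Fintype V] (M : MarkovChain V) : SimpleGraph V where
  Adj i j := i ≠ j ∧ 0 < M.rate i j
  symm := ⟨fun i j h => ⟨h.1.symm, (M.rate_pos_iff i j h.1).1 h.2⟩⟩
  loopless := ⟨fun _ h => h.1 rfl⟩

/-- The first Betti number `|E| - |V| + 1` of a (connected) finite graph. -/
noncomputable def firstBetti {V : Type*} [Fintype V] (G : SimpleGraph V) : ℤ :=
  (G.edgeSet.ncard : ℤ) - (Fintype.card V : ℤ) + 1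

/-- The potential gain of a trajectory, for given rates: the sum of `log (q_{ji} / q_{ij})` over
the steps `i → j` of the trajectory. -/
noncomputable def potentialGain {V : Type*} {G : SimpleGraph V} (q : Matrix V V ℝ) {u v : V}
    (w : G.Walk u v) : ℝ :=
  (w.darts.map fun d => Real.log (q d.snd d.fst / q d.fst d.snd)).sum

/-- The symbolic potential gain of a trajectory of `M`: the potential gain as a function of the
rates, which range over all Markov chains with the same states and the same possible transitions
as `M`. -/
noncomputable def MarkovChain.symbolicGain {V : Type*} [Fintype V] (M : MarkovChain V) {u v : V}
    (w : M.graph.Walk u v) : {N : MarkovChain V // N.graph = M.graph} → ℝ :=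
  fun N => potentialGain N.1.rate w

/-- The geometric realization of a finite graph, as a subset of `ℝ^V`: the vertices are the
standard basis vectors, the edges are the segments between adjacent ones. -/
def realization {V : Type*} [DecidableEq V] (G : SimpleGraph V) : Set (V → ℝ) :=
  {x | (∃ v, x = Pi.single v 1) ∨
    ∃ u v, G.Adj u v ∧ x ∈ segment ℝ (Pi.single u 1 : V → ℝ) (Pi.single v 1)}

/-- A vertex as a point of the geometric realization. -/
def vertexPt {V : Type*} [DecidableEq V] (G : SimpleGraph V) (v : V) : realization G :=
  ⟨Pi.single v 1, Or.inl ⟨v, rfl⟩⟩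

/-- The edge from `u` to `v`, run through at constant speed. -/
noncomputable def edgePath {V : Type*} [DecidableEq V] {G : SimpleGraph V} {u v : V}
    (h : G.Adj u v) : Path (vertexPt G u) (vertexPt G v) where
  toFun t := ⟨AffineMap.lineMap (Pi.single u 1 : V → ℝ) (Pi.single v 1) (t : ℝ), Or.inr
    ⟨u, v, h, by
      rw [segment_eq_image_lineMap]
      exact ⟨(t : ℝ), t.2, rfl⟩⟩⟩
  continuous_toFun := by
    refine Continuous.subtype_mk ?_ _
    exact AffineMap.lineMap_continuous.comp continuous_subtype_val
  source' := by simp [vertexPt]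
  target' := by simp [vertexPt]

/-- A trajectory as a curve in the geometric realization. -/
noncomputable def walkPath {V : Type*} [DecidableEq V] {G : SimpleGraph V} :
    {u v : V} → G.Walk u v → Path (vertexPt G u) (vertexPt G v)
  | _, _, SimpleGraph.Walk.nil => Path.refl _
  | _, _, SimpleGraph.Walk.cons h p => (edgePath h).trans (walkPath p)

/-- The `n`-torus, a product of `n` circles `ℝ / ℤ`. -/
abbrev Torus (n : ℕ) : Type := Fin n → UnitAddCircle

/-- The loop at `x` that runs once around the `i`-th circle factor and is constant in the others. -/
noncomputable def circleLoop {n : ℕ} (x : Torus n) (i : Fin n) : Path x x where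
  toFun t := x + Pi.single i ((t : ℝ) : UnitAddCircle)
  continuous_toFun := by
    refine continuous_const.add ((continuous_single i).comp ?_)
    exact (AddCircle.continuous_mk' (1 : ℝ)).comp continuous_subtype_val
  source' := by simp
  target' := by
    have h : ((1 : ℝ) : UnitAddCircle) = 0 := AddCircle.coe_period 1
    simp [h]

/-- A closed curve is homotopy trivial if it can be deformed, through closed curves (whose base
point may move), into a single point. -/
def HomotopyTrivial {X : Type*} [TopologicalSpace X] {x : X} (γ : Path x x) : Prop :=
  ∃ (H : C(I × I, X)) (c : X), (∀ t, H (0, t) = γ t) ∧ (∀ s, H (s, 0) = H (s, 1)) ∧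
    ∀ t, H (1, t) = c

/-- A choice of a spanning tree, and an enumeration by `Fin n` of the edges outside the tree, each
with an orientation. -/
structure CycleSystem {V : Type*} (G : SimpleGraph V) (n : ℕ) where
  tree : SimpleGraph V
  tree_le : tree ≤ G
  isTree : tree.IsTree
  special : Fin n → G.Dart
  bijOn : Set.BijOn (fun i => (special i).edge) Set.univ (G.edgeSet \ tree.edgeSet)

/-- The closed walk that runs along the `i`-th edge outside the tree and returns along `p`. If `p`
is the path in the tree, this is the `i`-th independent cycle. -/
def CycleSystem.closeUp {V : Type*} {G : SimpleGraph V} {n : ℕ} (C : CycleSystem G n) (i : Fin n)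
    (p : C.tree.Walk (C.special i).snd (C.special i).fst) :
    G.Walk (C.special i).fst (C.special i).fst :=
  SimpleGraph.Walk.cons (C.special i).adj (p.mapLe C.tree_le)

/-- Any two cycles of the graph have a common vertex. -/
def NoDisjointCycles {V : Type*} (G : SimpleGraph V) : Prop :=
  ∀ (u v : V) (p : G.Walk u u) (q : G.Walk v v), p.IsCycle → q.IsCycle →
    ∃ x, x ∈ p.support ∧ x ∈ q.support

/-- A map of the graph that is an embedding up to finitely many crossings of edges: no other point
is sent to the image of a vertex, every edge is injectively drawn, and there are only finitely many
pairs of distinct points with the same image. -/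
def IsDrawing {V : Type*} [DecidableEq V] {G : SimpleGraph V} {X : Type*}
    (f : realization G → X) : Prop :=
  (∀ v x, f x = f (vertexPt G v) → x = vertexPt G v) ∧
  (∀ (u v : V) (h : G.Adj u v), Function.Injective fun t : I => f (edgePath h t)) ∧
  {p : realization G × realization G | p.1 ≠ p.2 ∧ f p.1 = f p.2}.Finite

/-! Give every vertex a position in `ℝ^n`. Draw each tree edge as a straight segment and the `i`-th
edge outside the tree as the segment to the translate of its endpoint by the `i`-th unit vector,
then project to the torus. This map is `straightMap`; only the positions remain free.

For any positions, a closed walk lifts to a curve in `ℝ^n` whose displacement is `walkShift`, the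
vector of net traversals of the edges outside the tree. Linear homotopies of lifts give the
homotopies that are needed, and covering theory shows that nonzero displacement is an obstruction
(`homotopyTrivial_iff`). The gain is the sum of an antisymmetric weight; on the tree such a weight
is a difference of potentials, so zero displacement forces zero gain. Conversely, rates concentrated
on a single edge recover each entry of `walkShift` (`symbolicGain_eq_zero_iff`).

The embedding claims are settled by the choice of positions. Algebraically independent coordinates
serve for `n ≥ 3`: a crossing would annihilate a nonzero rational polynomial. For `n = 2` they leave
at most one crossing for each pair of edges and each integer translation, and only finitely many
translations matter. For `n = 1`, and for `n = 2` without disjoint cycles, the relevant part of the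
tree is drawn without crossings in a box of width less than one, such that each extra edge leaves
through one side and reenters through the opposite one (`injOn_straightMap_of_box`). In dimension
two the root is a common vertex of the two independent cycles, which allows both pairs of ends to be
pushed to opposite sides.

For the converse in dimension one, three edges at a vertex lift to curves in `ℝ` with a common
start, and two of them leave to the same side and overlap. Hence all degrees are at most two, and
the handshake lemma with `|E| = |V|` makes them equal to two. -/

/-! ### Coordinates on the torus. -/

/-- The coordinatewise projection of `ℝ^n` onto the torus. -/
def torusMk {n : ℕ} (x : Fin n → ℝ) : Torus n := fun k => (x k : UnitAddCircle)

theorem continuous_torusMk {n : ℕ} : Continuous (torusMk (n := n)) :=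
  continuous_pi fun k => (AddCircle.continuous_mk' (1 : ℝ)).comp (continuous_apply k)

theorem unitAddCircle_coe_eq_iff {x y : ℝ} :
    (x : UnitAddCircle) = y ↔ ∃ m : ℤ, x = y + m := by
  rw [← sub_eq_zero, ← AddCircle.coe_sub, AddCircle.coe_eq_zero_iff]
  constructor
  · rintro ⟨m, hm⟩
    exact ⟨m, by simp at hm; linarith⟩
  · rintro ⟨m, hm⟩
    exact ⟨m, by simp; linarith⟩

theorem torusMk_eq_iff {n : ℕ} {x y : Fin n → ℝ} :
    torusMk x = torusMk y ↔ ∃ m : Fin n → ℤ, ∀ k, x k = y k + m k := by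
  constructor
  · intro h
    have := fun k => unitAddCircle_coe_eq_iff.1 (congrFun h k)
    choose m hm using this
    exact ⟨m, hm⟩
  · rintro ⟨m, hm⟩
    exact funext fun k => unitAddCircle_coe_eq_iff.2 ⟨m k, hm k⟩

/-! ### Points of the geometric realization. -/

section Realization

variable {V : Type*} [DecidableEq V] {G : SimpleGraph V}

theorem edgePath_coe_apply {u v : V} (h : G.Adj u v) (t : I) (w : V) :
    (edgePath h t : V → ℝ) w = (if w = u then 1 - (t : ℝ) else 0) + if w = v then (t : ℝ) else 0 := by
  change (AffineMap.lineMap (Pi.single u 1 : V → ℝ) (Pi.single v 1) (t : ℝ)) w = _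
  simp only [AffineMap.lineMap_apply, vsub_eq_sub, vadd_eq_add, Pi.add_apply, Pi.smul_apply,
    Pi.sub_apply, Pi.single_apply, smul_eq_mul]
  split_ifs <;> ring

theorem edgePath_symm {u v : V} (h : G.Adj u v) (t : I) :
    edgePath h t = edgePath h.symm (unitInterval.symm t) := by
  apply Subtype.ext
  funext w
  rw [edgePath_coe_apply, edgePath_coe_apply, unitInterval.coe_symm_eq]
  split_ifs <;> ring

theorem edgePath_injective {u v : V} (h : G.Adj u v) : Function.Injective (edgePath h) := by
  intro s t hst
  have := congrFun (congrArg Subtype.val hst) v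
  rw [edgePath_coe_apply, edgePath_coe_apply] at this
  apply Subtype.ext
  simpa [h.ne'] using this

theorem exists_eq_edgePath_or_vertexPt (x : realization G) :
    (∃ v, x = vertexPt G v) ∨ ∃ (u v : V) (h : G.Adj u v) (t : I), x = edgePath h t := by
  obtain ⟨x, ⟨v, rfl⟩ | ⟨u, v, h, hx⟩⟩ := x
  · exact Or.inl ⟨v, rfl⟩
  · rw [segment_eq_image_lineMap] at hx
    obtain ⟨t, ht, rfl⟩ := hx
    exact Or.inr ⟨u, v, h, ⟨t, ht⟩, rfl⟩

theorem exists_eq_edgePath (hG : ∀ v, ∃ w, G.Adj v w) (x : realization G) :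
    ∃ (u v : V) (h : G.Adj u v) (t : I), x = edgePath h t := by
  rcases exists_eq_edgePath_or_vertexPt x with ⟨v, rfl⟩ | h
  · obtain ⟨w, hw⟩ := hG v
    exact ⟨v, w, hw, 0, (edgePath hw).source.symm⟩
  · exact h

instance [Finite V] : CompactSpace (realization G) := by
  rw [← isCompact_iff_compactSpace]
  have : realization G = (⋃ v, {(Pi.single v 1 : V → ℝ)}) ∪
      ⋃ p : {p : V × V // G.Adj p.1 p.2},
        segment ℝ (Pi.single p.1.1 1 : V → ℝ) (Pi.single p.1.2 1) := by
    ext x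
    simp [realization, eq_comm (b := x)]
  rw [this]
  refine (isCompact_iUnion fun v => isCompact_singleton).union (isCompact_iUnion fun p => ?_)
  rw [segment_eq_image_lineMap]
  exact isCompact_Icc.image AffineMap.lineMap_continuous

end Realization

/-! ### Signed incidences and the straight-line map into the torus. -/

namespace CycleSystem

variable {V : Type*} {G : SimpleGraph V} {n : ℕ}

theorem special_edge_injective (C : CycleSystem G n) :
    Function.Injective fun i => (C.special i).edge :=
  Set.injOn_univ.1 C.bijOn.injOn

theorem special_edge_notMem (C : CycleSystem G n) (i : Fin n) :
    (C.special i).edge ∉ C.tree.edgeSet := (C.bijOn.mapsTo (Set.mem_univ i)).2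

theorem special_notAdj (C : CycleSystem G n) (i : Fin n) :
    ¬ C.tree.Adj (C.special i).fst (C.special i).snd := C.special_edge_notMem i

theorem eq_of_special_eq (C : CycleSystem G n) {i j : Fin n}
    (h : (C.special i).fst = (C.special j).fst ∧ (C.special i).snd = (C.special j).snd ∨
      (C.special i).fst = (C.special j).snd ∧ (C.special i).snd = (C.special j).fst) : i = j := by
  apply C.special_edge_injective
  change s((C.special i).fst, (C.special i).snd) = s((C.special j).fst, (C.special j).snd)
  rw [Sym2.eq_iff]
  exact h

theorem adj_cases (C : CycleSystem G n) {u v : V} (h : G.Adj u v) :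
    C.tree.Adj u v ∨ ∃ i, (C.special i).fst = u ∧ (C.special i).snd = v ∨
      (C.special i).fst = v ∧ (C.special i).snd = u := by
  by_cases ht : C.tree.Adj u v
  · exact Or.inl ht
  · obtain ⟨i, -, hi⟩ := C.bijOn.surjOn (show s(u, v) ∈ G.edgeSet \ C.tree.edgeSet from ⟨h, ht⟩)
    have hi' : s((C.special i).fst, (C.special i).snd) = s(u, v) := hi
    rw [Sym2.eq_iff] at hi'
    exact Or.inr ⟨i, hi'⟩

variable [DecidableEq V]

/-- The signed incidence of the step `u → v` with the `k`-th edge outside the tree. -/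
def shift (C : CycleSystem G n) (u v : V) (k : Fin n) : ℤ :=
  if (C.special k).fst = u ∧ (C.special k).snd = v then 1
  else if (C.special k).fst = v ∧ (C.special k).snd = u then -1 else 0

theorem shift_symm (C : CycleSystem G n) (u v : V) (k : Fin n) :
    C.shift v u k = - C.shift u v k := by
  have := (C.special k).adj.ne
  unfold shift
  split_ifs <;> simp_all

theorem shift_of_tree (C : CycleSystem G n) {u v : V} (h : C.tree.Adj u v) (k : Fin n) :
    C.shift u v k = 0 := by
  have := C.special_notAdj k
  unfold shift
  split_ifs with h1 h2
  · rw [h1.1, h1.2] at this; exact absurd h this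
  · rw [h2.1, h2.2] at this; exact absurd h.symm this
  · rfl

theorem shift_special (C : CycleSystem G n) (i k : Fin n) :
    C.shift (C.special i).fst (C.special i).snd k = if k = i then 1 else 0 := by
  unfold shift
  split_ifs with h1 h2 h3 h4 h5
  · rfl
  · exact absurd (C.eq_of_special_eq (Or.inl h1)) h2
  · exact absurd (h4 ▸ ⟨rfl, rfl⟩) h1
  · exact absurd (C.eq_of_special_eq (Or.inr h3)) h4
  · exact absurd (h5 ▸ ⟨rfl, rfl⟩) h1
  · rfl

/-- The position on the `k`-th circle while running through the `k`-th edge outside the tree, and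
zero elsewhere. -/
noncomputable def circleCoord (C : CycleSystem G n) (k : Fin n) (x : V → ℝ) : UnitAddCircle :=
  -- On the `k`-th special edge the two coordinates are `1 - t` and `t`; the branches give `t` and
  -- `t - 1`, which agree modulo 1.
  if x (C.special k).snd ≤ x (C.special k).fst
  then ((min (x (C.special k).fst) (x (C.special k).snd) : ℝ) : UnitAddCircle)
  else ((- min (x (C.special k).fst) (x (C.special k).snd) : ℝ) : UnitAddCircle)

theorem circleCoord_edgePath (C : CycleSystem G n) (k : Fin n) {u v : V} (h : G.Adj u v) (t : I) :
    C.circleCoord k (edgePath h t) = (((t : ℝ) * C.shift u v k : ℝ) : UnitAddCircle) := by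
  have hne := (C.special k).adj.ne
  have huv := h.ne
  have h0 := t.2.1
  have h1 := t.2.2
  unfold circleCoord shift
  rw [edgePath_coe_apply, edgePath_coe_apply]
  by_cases c1 : (C.special k).fst = u ∧ (C.special k).snd = v
  · rw [if_pos c1, c1.1, c1.2]
    simp only [huv, huv.symm, if_true, if_false, add_zero, zero_add]
    split_ifs with hle
    · rw [min_eq_right hle]; simp
    · rw [min_eq_left (not_le.1 hle).le, unitAddCircle_coe_eq_iff]
      exact ⟨-1, by push_cast; ring⟩
  rw [if_neg c1]
  by_cases c2 : (C.special k).fst = v ∧ (C.special k).snd = u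
  · rw [if_pos c2, c2.1, c2.2]
    simp only [huv, huv.symm, if_true, if_false, add_zero, zero_add]
    split_ifs with hle
    · rw [min_eq_right hle, unitAddCircle_coe_eq_iff]
      exact ⟨1, by push_cast; ring⟩
    · rw [min_eq_left (not_le.1 hle).le]; simp
  rw [if_neg c2]
  have hmin : min ((if (C.special k).fst = u then 1 - (t : ℝ) else 0) +
      if (C.special k).fst = v then (t : ℝ) else 0)
      ((if (C.special k).snd = u then 1 - (t : ℝ) else 0) +
      if (C.special k).snd = v then (t : ℝ) else 0) = 0 := by
    by_cases a1 : (C.special k).fst = u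
    · have a2 : (C.special k).snd ≠ u := fun h => hne (a1.trans h.symm)
      have a3 : (C.special k).snd ≠ v := fun h => c1 ⟨a1, h⟩
      simp only [a1, a2, a3, huv, if_true, if_false]
      rw [min_eq_right] <;> linarith
    · by_cases b1 : (C.special k).fst = v
      · have b2 : (C.special k).snd ≠ v := fun h => hne (b1.trans h.symm)
        have b3 : (C.special k).snd ≠ u := fun h => c2 ⟨b1, h⟩
        simp only [b1, b2, b3, huv.symm, if_true, if_false]
        rw [min_eq_right] <;> linarith
      · simp only [a1, b1, if_false]
        rw [min_eq_left] <;> [norm_num; skip]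
        split_ifs <;> linarith
  rw [hmin]
  simp

theorem circleCoord_vertexPt (C : CycleSystem G n) (k : Fin n) (v : V) :
    C.circleCoord k (vertexPt G v : V → ℝ) = 0 := by
  have hne := (C.special k).adj.ne
  unfold circleCoord vertexPt
  simp only [Pi.single_apply]
  split_ifs <;> simp_all

theorem continuous_circleCoord (C : CycleSystem G n) (k : Fin n) :
    Continuous fun x : realization G => C.circleCoord k (x : V → ℝ) := by
  have hc : ∀ v : V, Continuous fun x : realization G => (x : V → ℝ) v := fun v =>
    (continuous_apply v).comp continuous_subtype_val
  unfold circleCoord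
  refine Continuous.if_le ?_ ?_ (hc _) (hc _) ?_
  · exact (AddCircle.continuous_mk' (1 : ℝ)).comp ((hc _).min (hc _))
  · exact (AddCircle.continuous_mk' (1 : ℝ)).comp ((hc _).min (hc _)).neg
  · intro x hx
    rw [hx, min_self]
    have hne := (C.special k).adj.ne
    rw [unitAddCircle_coe_eq_iff]
    -- The branches `a` and `-a` agree in `ℝ / ℤ` when `2 * a` is an integer. Where the two
    -- coordinates coincide on the realization, they are 0, or 1/2 at the midpoint of the special
    -- edge.
    suffices h : ∃ m : ℤ, 2 * (x : V → ℝ) (C.special k).fst = m by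
      obtain ⟨m, hm⟩ := h
      exact ⟨m, by linarith⟩
    rcases exists_eq_edgePath_or_vertexPt x with ⟨v, rfl⟩ | ⟨u, v, h, t, rfl⟩
    · simp only [vertexPt, Pi.single_apply]
      split_ifs
      · exact ⟨2, by norm_num⟩
      · exact ⟨0, by norm_num⟩
    · rw [edgePath_coe_apply, edgePath_coe_apply] at hx
      rw [edgePath_coe_apply]
      by_cases a1 : (C.special k).fst = u <;> by_cases a2 : (C.special k).fst = v <;>
        by_cases a3 : (C.special k).snd = u <;> by_cases a4 : (C.special k).snd = v <;>
        simp only [a1, a2, a3, a4, if_true, if_false, h.ne, h.ne', add_zero, zero_add] at hx ⊢ <;>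
        first
        | exact ⟨0, by push_cast; linarith⟩
        | exact ⟨1, by push_cast; linarith⟩
        | (exfalso; simp_all)

/-- The lift to `ℝ^n` of the straight-line drawing, along the edge from `u` to `v`, when the
vertices have the positions `p`. -/
def segmentLift (C : CycleSystem G n) (p : V → Fin n → ℝ) (u v : V) (t : ℝ) (k : Fin n) : ℝ :=
  p u k + t * (p v k + C.shift u v k - p u k)

/-- The straight-line drawing of the graph in the torus with given vertex positions. -/
noncomputable def straightMap [Fintype V] (C : CycleSystem G n) (p : V → Fin n → ℝ) :
    C(realization G, Torus n) where
  -- A global formula in barycentric coordinates, so that continuity needs no gluing along edges.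
  toFun x k := ((∑ v, (x : V → ℝ) v * p v k : ℝ) : UnitAddCircle) + C.circleCoord k x
  continuous_toFun := by
    refine continuous_pi fun k => Continuous.add ?_ (C.continuous_circleCoord k)
    refine (AddCircle.continuous_mk' (1 : ℝ)).comp ?_
    exact continuous_finsetSum _ fun v _ =>
      ((continuous_apply v).comp continuous_subtype_val).mul continuous_const

theorem straightMap_edgePath [Fintype V] (C : CycleSystem G n) (p : V → Fin n → ℝ) {u v : V}
    (h : G.Adj u v) (t : I) :
    C.straightMap p (edgePath h t) = torusMk (C.segmentLift p u v t) := by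
  funext k
  change ((∑ w, (edgePath h t : V → ℝ) w * p w k : ℝ) : UnitAddCircle) + C.circleCoord k _ = _
  rw [circleCoord_edgePath, ← AddCircle.coe_add]
  unfold torusMk segmentLift
  congr 1
  simp only [edgePath_coe_apply, add_mul, ite_mul, zero_mul, Finset.sum_add_distrib,
    Finset.sum_ite_eq', Finset.mem_univ, if_true]
  ring

theorem straightMap_vertexPt [Fintype V] (C : CycleSystem G n) (p : V → Fin n → ℝ) (v : V) :
    C.straightMap p (vertexPt G v) = torusMk (p v) := by
  funext k
  change ((∑ w, (vertexPt G v : V → ℝ) w * p w k : ℝ) : UnitAddCircle) + C.circleCoord k _ = _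
  rw [circleCoord_vertexPt, add_zero]
  simp [torusMk, vertexPt, Pi.single_apply]

end CycleSystem

/-! ### Rooted trees and ancestors. -/

/-- A description of a tree by the parent function that belongs to the root `r`. -/
structure Rooting {V : Type*} (T : SimpleGraph V) (r : V) where
  parent : V → V
  depth : V → ℕ
  parent_root : parent r = r
  depth_root : depth r = 0
  adj_parent : ∀ v, v ≠ r → T.Adj v (parent v)
  depth_eq : ∀ v, v ≠ r → depth v = depth (parent v) + 1
  parent_of_adj : ∀ u v, T.Adj u v → (u ≠ r ∧ parent u = v) ∨ (v ≠ r ∧ parent v = u)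

/-- The parent is the neighbour closer to the root. It is unique because two such neighbours would
give two shortest walks, hence two paths, from the root. -/
theorem SimpleGraph.IsTree.nonempty_rooting {V : Type*} {T : SimpleGraph V} (hT : T.IsTree)
    (r : V) : Nonempty (Rooting T r) := by
  classical
  have key : ∀ u u' v, T.Adj u v → T.Adj u' v → T.dist r v = T.dist r u + 1 →
      T.dist r v = T.dist r u' + 1 → u = u' := by
    intro u u' v hu hu' h h'
    obtain ⟨q, hq⟩ := (hT.connected.preconnected r u).exists_walk_length_eq_dist
    obtain ⟨q', hq'⟩ := (hT.connected.preconnected r u').exists_walk_length_eq_dist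
    have e : q.concat hu = q'.concat hu' := by
      refine (hT.existsUnique_path r v).unique ?_ ?_ <;>
        refine SimpleGraph.Walk.isPath_of_length_eq_dist _ ?_ <;>
        rw [SimpleGraph.Walk.length_concat] <;> omega
    have := congrArg SimpleGraph.Walk.penultimate e
    simpa using this
  have ex : ∀ v, ∃ w, (v = r → w = r) ∧ (v ≠ r → T.Adj v w ∧ T.dist r v = T.dist r w + 1) := by
    intro v
    by_cases hv : v = r
    · exact ⟨r, fun _ => rfl, fun h => absurd hv h⟩
    obtain ⟨q, hq⟩ := (hT.connected.preconnected v r).exists_walk_length_eq_dist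
    cases q with
    | nil => exact absurd rfl hv
    | cons h q =>
      rename_i w
      refine ⟨w, fun h => absurd h hv, fun _ => ⟨h, ?_⟩⟩
      rw [SimpleGraph.Walk.length_cons] at hq
      have h1 := SimpleGraph.dist_le q
      rw [T.dist_comm (u := r) (v := v), T.dist_comm (u := r) (v := w)]
      rcases hT.dist_eq_dist_add_one_of_adj r h with h2 | h2 <;>
        rw [T.dist_comm (u := r) (v := v), T.dist_comm (u := r) (v := w)] at h2 <;> omega
  choose par hroot hpar using ex
  refine ⟨⟨par, T.dist r, hroot r rfl, SimpleGraph.dist_self, fun v hv => (hpar v hv).1,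
    fun v hv => (hpar v hv).2, ?_⟩⟩
  intro u v huv
  have aux : ∀ u v, T.Adj u v → T.dist r u = T.dist r v + 1 → u ≠ r ∧ par u = v := by
    intro u v huv h
    have hu : u ≠ r := by
      rintro rfl
      simp at h
    exact ⟨hu, key _ _ u (hpar u hu).1.symm huv.symm (hpar u hu).2 h⟩
  rcases hT.dist_eq_dist_add_one_of_adj r huv with h | h
  · exact Or.inl (aux u v huv h)
  · exact Or.inr (aux v u huv.symm h)

namespace Rooting

variable {V : Type*} {T : SimpleGraph V} {r : V} (R : Rooting T r)

/-- `w` lies on the tree path from `v` to the root. -/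
def Anc (w v : V) : Prop := ∃ k, R.parent^[k] v = w

theorem anc_refl (v : V) : R.Anc v v := ⟨0, rfl⟩

theorem anc_parent (v : V) : R.Anc (R.parent v) v := ⟨1, rfl⟩

theorem Anc.trans {R : Rooting T r} {u v w : V} (h : R.Anc u v) (h' : R.Anc v w) : R.Anc u w := by
  obtain ⟨k, rfl⟩ := h
  obtain ⟨l, rfl⟩ := h'
  exact ⟨k + l, Function.iterate_add_apply _ _ _ _⟩

theorem anc_cases {w v : V} (h : R.Anc w v) : w = v ∨ R.Anc w (R.parent v) := by
  obtain ⟨k, rfl⟩ := h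
  cases k with
  | zero => exact Or.inl rfl
  | succ k => exact Or.inr ⟨k, rfl⟩

theorem eq_root_of_depth_eq_zero {v : V} (h : R.depth v = 0) : v = r := by
  by_contra hv
  have := R.depth_eq v hv
  omega

theorem root_anc (v : V) : R.Anc r v := by
  induction h : R.depth v generalizing v with
  | zero => rw [R.eq_root_of_depth_eq_zero h]; exact R.anc_refl _
  | succ k ih =>
    have hv : v ≠ r := by
      rintro rfl
      rw [R.depth_root] at h
      omega
    have := R.depth_eq v hv
    exact (ih (R.parent v) (by omega)).trans (R.anc_parent v)

theorem depth_le_of_anc {w v : V} (h : R.Anc w v) : R.depth w ≤ R.depth v := by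
  obtain ⟨k, rfl⟩ := h
  induction k generalizing v with
  | zero => exact le_rfl
  | succ k ih =>
    refine ih.trans ?_
    by_cases hv : v = r
    · rw [hv, R.parent_root]
    · rw [R.depth_eq v hv]; omega

theorem eq_of_anc_of_depth_le {w v : V} (h : R.Anc w v) (hd : R.depth v ≤ R.depth w) :
    w = v := by
  rcases R.anc_cases h with h | h
  · exact h
  · by_cases hv : v = r
    · subst hv
      rw [R.parent_root] at h
      have := R.depth_le_of_anc h
      have := R.depth_root
      exact R.eq_root_of_depth_eq_zero (by omega)
    · have := R.depth_le_of_anc h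
      have := R.depth_eq v hv
      omega

theorem anc_root_iff {w : V} : R.Anc w r ↔ w = r := by
  constructor
  · intro h
    have := R.depth_le_of_anc h
    exact R.eq_root_of_depth_eq_zero (by rw [R.depth_root] at this; omega)
  · rintro rfl
    exact R.anc_refl _

/-- The ancestors of a vertex form a chain. -/
theorem anc_total {u w v : V} (hu : R.Anc u v) (hw : R.Anc w v) : R.Anc u w ∨ R.Anc w u := by
  obtain ⟨k, rfl⟩ := hu
  obtain ⟨l, rfl⟩ := hw
  rcases le_total k l with h | h
  · refine Or.inr ⟨l - k, ?_⟩
    rw [← Function.iterate_add_apply, Nat.sub_add_cancel h]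
  · refine Or.inl ⟨k - l, ?_⟩
    rw [← Function.iterate_add_apply, Nat.sub_add_cancel h]

theorem eq_of_anc_of_depth_eq {u w v : V} (hu : R.Anc u v) (hw : R.Anc w v)
    (h : R.depth u = R.depth w) : u = w := by
  rcases R.anc_total hu hw with h' | h'
  · exact R.eq_of_anc_of_depth_le h' h.ge
  · exact (R.eq_of_anc_of_depth_le h' h.le).symm

/-- A step to a child keeps every ancestor, and a step to the parent loses only the vertex being
left. So an ancestor can only be lost by visiting it. -/
theorem mem_support_of_anc {v x w : V} (q : T.Walk v x) (hx : x = r) (h : R.Anc w v) :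
    w ∈ q.support := by
  induction q with
  | nil =>
    subst hx
    simp [R.anc_root_iff.1 h]
  | cons huv q ih =>
    rw [SimpleGraph.Walk.support_cons, List.mem_cons]
    rcases R.parent_of_adj _ _ huv with ⟨-, e⟩ | ⟨-, e⟩
    · rcases R.anc_cases h with h | h
      · exact Or.inl h
      · exact Or.inr (ih hx (e ▸ h))
    · exact Or.inr (ih hx (h.trans (e ▸ R.anc_parent _)))

/-- If the root lies on the tree path between two vertices, they have no other common ancestor. -/
theorem eq_root_of_anc_of_anc {a b w : V} {q : T.Walk b a} (hq : q.IsPath) (hr : r ∈ q.support)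
    (ha : R.Anc w a) (hb : R.Anc w b) : w = r := by
  obtain ⟨q₁, q₂, -, -, rfl⟩ := hq.mem_support_iff_exists_append.1 hr
  by_contra hw
  -- Otherwise `w` lies on both halves of a path cut at `r`, although halves of a path share only
  -- the cut point.
  refine hq.ne_of_mem_support_of_append hw (R.mem_support_of_anc q₁ rfl hb) ?_ rfl
  have := R.mem_support_of_anc q₂.reverse rfl ha
  simpa using this

/-- The potential of an antisymmetric function on the edges of the tree. -/
def potential (L : V → V → ℝ) (v : V) : ℝ :=
  ∑ k ∈ Finset.range (R.depth v), L (R.parent^[k + 1] v) (R.parent^[k] v)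

theorem potential_eq (L : V → V → ℝ) {v : V} (hv : v ≠ r) :
    R.potential L v = R.potential L (R.parent v) + L (R.parent v) v := by
  unfold potential
  rw [R.depth_eq v hv, Finset.sum_range_succ']
  rfl

theorem potential_sub (L : V → V → ℝ) (hL : ∀ u v, L v u = - L u v) {u v : V} (h : T.Adj u v) :
    R.potential L v - R.potential L u = L u v := by
  rcases R.parent_of_adj _ _ h with ⟨hu, rfl⟩ | ⟨hv, rfl⟩
  · rw [R.potential_eq L hu, hL u (R.parent u)]
    ring
  · rw [R.potential_eq L hv]
    ring

end Rooting

/-! ### Lifts of walks, homotopy and antisymmetric weights. -/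

namespace CycleSystem

variable {V : Type*} [DecidableEq V] {G : SimpleGraph V} {n : ℕ}

/-- The net number of traversals of the `k`-th edge outside the tree. -/
def walkShift (C : CycleSystem G n) {u v : V} (w : G.Walk u v) (k : Fin n) : ℤ :=
  (w.darts.map fun d => C.shift d.fst d.snd k).sum

theorem walkShift_cons (C : CycleSystem G n) {u v x : V} (h : G.Adj u v) (w : G.Walk v x)
    (k : Fin n) : C.walkShift (.cons h w) k = C.shift u v k + C.walkShift w k := by
  simp [walkShift]

theorem walkShift_mapLe (C : CycleSystem G n) {u v : V} (w : C.tree.Walk u v) (k : Fin n) :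
    C.walkShift (w.mapLe C.tree_le) k = 0 := by
  induction w with
  | nil => rfl
  | cons h w ih =>
    change C.walkShift (.cons (C.tree_le h) (w.mapLe C.tree_le)) k = 0
    rw [walkShift_cons, ih, C.shift_of_tree h, add_zero]

theorem walkShift_closeUp (C : CycleSystem G n) (i : Fin n)
    (p : C.tree.Walk (C.special i).snd (C.special i).fst) (k : Fin n) :
    C.walkShift (C.closeUp i p) k = if k = i then 1 else 0 := by
  unfold closeUp
  rw [walkShift_cons, walkShift_mapLe, add_zero, shift_special]

/-- The image of a trajectory in the torus lifts to a curve in `ℝ^n` whose displacement counts the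
net traversals of the edges outside the tree. -/
theorem exists_lift_walkPath [Fintype V] (C : CycleSystem G n) (p : V → Fin n → ℝ) {u v : V}
    (w : G.Walk u v) :
    ∃ Γ : Path (p u) (fun k => p v k + C.walkShift w k),
      ∀ t, C.straightMap p (walkPath w t) = torusMk (Γ t) := by
  induction w with
  | nil =>
    refine ⟨(Path.refl _).cast rfl (by funext k; simp [walkShift]), fun t => ?_⟩
    simp [walkPath, straightMap_vertexPt]
  | @cons u v x h w ih =>
    obtain ⟨Γ, hΓ⟩ := ih
    let γ : Path (p u) (fun k => p v k + C.shift u v k) :=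
      { toFun := fun t => C.segmentLift p u v t
        continuous_toFun := by
          unfold segmentLift
          fun_prop
        source' := by funext k; simp [segmentLift]
        target' := by funext k; simp [segmentLift] }
    let Γ' : Path (fun k => p v k + C.shift u v k)
        (fun k => p x k + C.walkShift (.cons h w) k) :=
      { toFun := fun t k => Γ t k + C.shift u v k
        continuous_toFun := by
          have := Γ.continuous
          fun_prop
        source' := by funext k; simp
        target' := by funext k; simp [walkShift_cons]; ring }
    refine ⟨γ.trans Γ', fun t => ?_⟩
    rw [walkPath, Path.trans_apply, Path.trans_apply]
    split_ifs with ht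
    · exact C.straightMap_edgePath p h _
    · rw [hΓ]
      exact torusMk_eq_iff.2 ⟨fun k => - C.shift u v k, fun k => by simp [Γ']⟩

/-- Both loops lift to curves in `ℝ^n` with the same endpoints; the straight-line homotopy between
the lifts is projected. -/
theorem homotopic_circleLoop [Fintype V] (C : CycleSystem G n) (p : V → Fin n → ℝ) (i : Fin n)
    (q : C.tree.Walk (C.special i).snd (C.special i).fst) :
    Path.Homotopic ((walkPath (C.closeUp i q)).map (C.straightMap p).continuous)
      (circleLoop _ i) := by
  obtain ⟨Γ, hΓ⟩ := C.exists_lift_walkPath p (C.closeUp i q)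
  have hloop : ∀ t : I, circleLoop (C.straightMap p (vertexPt G (C.special i).fst)) i t =
      torusMk fun k => p (C.special i).fst k + (t : ℝ) * if k = i then 1 else 0 := by
    intro t
    change C.straightMap p (vertexPt G _) + Pi.single i ((t : ℝ) : UnitAddCircle) = _
    rw [straightMap_vertexPt]
    funext k
    by_cases hk : k = i
    · subst hk; simp [torusMk]
    · simp [torusMk, hk]
  refine ⟨{
    toFun := fun x => torusMk fun k =>
      (1 - (x.1 : ℝ)) * Γ x.2 k + x.1 * (p (C.special i).fst k + (x.2 : ℝ) * if k = i then 1 else 0)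
    continuous_toFun := continuous_torusMk.comp (by
      have := Γ.continuous
      fun_prop)
    map_zero_left := fun t => by
      change torusMk _ = C.straightMap p (walkPath (C.closeUp i q) t)
      rw [hΓ]
      congr 1
      funext k
      simp
    map_one_left := fun t => by
      change torusMk _ = circleLoop (C.straightMap p (vertexPt G (C.special i).fst)) i t
      rw [hloop]
      congr 1
      funext k
      simp
    prop' := ?_ }⟩
  intro s t ht
  change torusMk _ = C.straightMap p (walkPath (C.closeUp i q) t)
  rw [hΓ]
  congr 1
  funext k
  rcases ht with rfl | rfl
  · simp; ring
  · simp [walkShift_closeUp]; ring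

theorem homotopyTrivial_of_walkShift_eq_zero [Fintype V] (C : CycleSystem G n)
    (p : V → Fin n → ℝ) {v : V} (w : G.Walk v v) (h : ∀ k, C.walkShift w k = 0) :
    HomotopyTrivial ((walkPath w).map (C.straightMap p).continuous) := by
  obtain ⟨Γ, hΓ⟩ := C.exists_lift_walkPath p w
  refine ⟨⟨fun x => torusMk fun k => (1 - (x.1 : ℝ)) * Γ x.2 k + x.1 * p v k,
    continuous_torusMk.comp (by have := Γ.continuous; fun_prop)⟩, torusMk (p v), ?_, ?_, ?_⟩
  · intro t
    simpa using (hΓ t).symm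
  · intro s
    simp [h]
  · intro t
    simp

end CycleSystem

/-- A curve in the circle with a non-closed lift is not homotopy trivial. -/
theorem HomotopyTrivial.lift_eq {x : UnitAddCircle} {γ : Path x x} (h : HomotopyTrivial γ)
    (Γ : C(I, ℝ)) (hΓ : ∀ t, (Γ t : UnitAddCircle) = γ t) : Γ 0 = Γ 1 := by
  obtain ⟨H, c, h0, hloop, h1⟩ := h
  have cov : IsCoveringMap ((↑) : ℝ → UnitAddCircle) := AddCircle.isCoveringMap_coe 1
  have H0 : ∀ t, H (0, t) = (Γ t : UnitAddCircle) := fun t => by rw [h0, hΓ]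
  set K := cov.liftHomotopy H Γ H0 with hK
  have hl : ∀ y, (K y : UnitAddCircle) = H y := fun y => congrFun (cov.liftHomotopy_lifts H Γ H0) y
  have hz : ∀ t, K (0, t) = Γ t := fun t => cov.liftHomotopy_zero H Γ H0 t
  have hint : ∀ a b : I × I, H a = H b → ∃ m : ℤ, K a - K b = m := by
    intro a b hab
    rw [← hl, ← hl, unitAddCircle_coe_eq_iff] at hab
    obtain ⟨m, hm⟩ := hab
    exact ⟨m, by linarith⟩
  have const : ∀ g : C(I, ℝ), (∀ s, ∃ m : ℤ, g s = m) → ∀ s t, g s = g t := by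
    intro g hg s t
    have hr : (Set.range g).Countable :=
      (Set.countable_range (fun m : ℤ => (m : ℝ))).mono (by
        rintro _ ⟨s, rfl⟩
        obtain ⟨m, hm⟩ := hg s
        exact ⟨m, hm.symm⟩)
    exact hr.isTotallyDisconnected _ subset_rfl (isPreconnected_range g.continuous) ⟨s, rfl⟩ ⟨t, rfl⟩
  -- The displacement of the lifted curve at time `s` is a continuous integer, hence independent of
  -- `s`; at `s = 1` the curve is constant and the displacement is 0.
  have e1 := const ⟨fun s => K (s, 1) - K (s, 0), by fun_prop⟩
    (fun s => hint _ _ (hloop s).symm) 0 1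
  have e2 := const ⟨fun t => K (1, t) - K (1, 0), by fun_prop⟩
    (fun t => hint _ _ (by rw [h1, h1])) 1 0
  simp only [ContinuousMap.coe_mk, hz] at e1 e2
  linarith

namespace CycleSystem

variable {V : Type*} [DecidableEq V] {G : SimpleGraph V} {n : ℕ}

theorem homotopyTrivial_iff [Fintype V] (C : CycleSystem G n)
    (p : V → Fin n → ℝ) {v : V} (w : G.Walk v v) :
    HomotopyTrivial ((walkPath w).map (C.straightMap p).continuous) ↔
      ∀ k, C.walkShift w k = 0 := by
  refine ⟨fun ⟨H, c, h0, h1, h2⟩ k => ?_, C.homotopyTrivial_of_walkShift_eq_zero p w⟩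
  obtain ⟨Γ, hΓ⟩ := C.exists_lift_walkPath p w
  have hk : HomotopyTrivial (((walkPath w).map (C.straightMap p).continuous).map
      (continuous_apply k)) :=
    ⟨⟨fun x => H x k, by fun_prop⟩, c k, fun t => congrFun (h0 t) k, fun s => congrFun (h1 s) k,
      fun t => congrFun (h2 t) k⟩
  have := hk.lift_eq ⟨fun t => Γ t k, by have := Γ.continuous; fun_prop⟩
    (fun t => (congrFun (hΓ t) k).symm)
  simpa using this

/-- An antisymmetric weight sums up to zero along a closed walk without net traversals of the edges
outside the tree. -/
theorem sum_darts_eq_zero (C : CycleSystem G n) {L : V → V → ℝ} (hL : ∀ u v, L v u = - L u v)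
    {v : V} (w : G.Walk v v) (h : ∀ k, C.walkShift w k = 0) :
    (w.darts.map fun d => L d.fst d.snd).sum = 0 := by
  obtain ⟨R⟩ := C.isTree.nonempty_rooting v
  -- For arbitrary walks, to allow induction: the sum is the potential difference plus, for each
  -- special edge, its net traversals times its deviation from the potential.
  have key : ∀ {x y : V} (w : G.Walk x y), (w.darts.map fun d => L d.fst d.snd).sum =
      R.potential L y - R.potential L x + ∑ k, C.walkShift w k *
        (L (C.special k).fst (C.special k).snd -
          (R.potential L (C.special k).snd - R.potential L (C.special k).fst)) := by
    intro x y w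
    induction w with
    | nil => simp [walkShift]
    | @cons x y z hxy w ih =>
      have hstep : L x y = R.potential L y - R.potential L x + ∑ k, C.shift x y k *
        (L (C.special k).fst (C.special k).snd -
          (R.potential L (C.special k).snd - R.potential L (C.special k).fst)) := by
        rcases C.adj_cases hxy with ht | ⟨i, ⟨rfl, rfl⟩ | ⟨rfl, rfl⟩⟩
        · simp [C.shift_of_tree ht, R.potential_sub L hL ht]
        · simp [shift_special]
        · simp only [C.shift_symm (C.special i).fst, shift_special]
          simp [hL (C.special i).fst]
          ring
      simp only [walkShift_cons, Int.cast_add, add_mul, Finset.sum_add_distrib,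
        SimpleGraph.Walk.darts_cons, List.map_cons, List.sum_cons, ih]
      rw [hstep]
      ring
  rw [key]
  simp [h]

end CycleSystem

/-! ### Symbolic potential gain. -/

/-- The Markov chain on a connected graph with given positive rates on the edges. -/
noncomputable def MarkovChain.ofRates {V : Type*} [Fintype V] (M : MarkovChain V)
    (g : V → V → ℝ) (hg : ∀ i j, 0 < g i j) : MarkovChain V := by
  classical
  exact
  { rate := fun i j => if i = j then - ∑ k, (if M.graph.Adj i k then g i k else 0)
      else if M.graph.Adj i j then g i j else 0
    rate_nonneg := fun i j hij => by
      rw [if_neg hij]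
      split_ifs
      exacts [(hg i j).le, le_rfl]
    row_sum := fun i => by
      rw [← Finset.add_sum_erase _ _ (Finset.mem_univ i), if_pos rfl,
        ← Finset.add_sum_erase _ (fun k => if M.graph.Adj i k then g i k else 0)
          (Finset.mem_univ i), if_neg (M.graph.loopless.irrefl i), zero_add, neg_add_eq_zero]
      refine Finset.sum_congr rfl fun k hk => ?_
      rw [if_neg (Finset.ne_of_mem_erase hk).symm]
    rate_pos_iff := fun i j hij => by
      rw [if_neg hij, if_neg hij.symm, M.graph.adj_comm j i]
      split_ifs
      · exact ⟨fun _ => hg _ _, fun _ => hg _ _⟩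
      · rfl
    irreducible := fun i j => Relation.ReflTransGen.mono (fun a b hab => ⟨hab.1, by
      have : M.graph.Adj a b := hab
      rw [if_neg hab.1, if_pos this]
      exact hg a b⟩) _ _ (M.irreducible i j) }

theorem MarkovChain.ofRates_rate {V : Type*} [Fintype V] (M : MarkovChain V)
    (g : V → V → ℝ) (hg : ∀ i j, 0 < g i j) {i j : V} (h : M.graph.Adj i j) :
    (M.ofRates g hg).rate i j = g i j := by
  simp [ofRates, h, h.ne]

theorem MarkovChain.ofRates_graph {V : Type*} [Fintype V] (M : MarkovChain V)
    (g : V → V → ℝ) (hg : ∀ i j, 0 < g i j) : (M.ofRates g hg).graph = M.graph := by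
  ext i j
  constructor
  · rintro ⟨hij, h⟩
    by_contra hadj
    simp [ofRates, hadj, hij] at h
  · intro h
    refine ⟨h.ne, ?_⟩
    rw [M.ofRates_rate g hg h]
    exact hg i j

theorem MarkovChain.symbolicGain_eq_zero_iff {V : Type*} [Fintype V] [DecidableEq V]
    (M : MarkovChain V) {n : ℕ} (C : CycleSystem M.graph n) {v : V} (w : M.graph.Walk v v) :
    M.symbolicGain w = 0 ↔ ∀ k, C.walkShift w k = 0 := by
  constructor
  · intro h k
    -- Rate `e` against the `k`-th special edge and 1 on all other steps: the gain of each step is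
    -- its signed incidence with that edge.
    let g : V → V → ℝ := fun i j => Real.exp
      (if (C.special k).fst = j ∧ (C.special k).snd = i then 1 else 0)
    have hg : ∀ i j, 0 < g i j := fun i j => Real.exp_pos _
    have := congrFun h ⟨M.ofRates g hg, M.ofRates_graph g hg⟩
    change (w.darts.map fun d => _).sum = 0 at this
    have e : ∀ d : M.graph.Dart, Real.log ((M.ofRates g hg).rate d.snd d.fst /
        (M.ofRates g hg).rate d.fst d.snd) = ((C.shift d.fst d.snd k : ℤ) : ℝ) := by
      intro d
      rw [M.ofRates_rate g hg d.adj, M.ofRates_rate g hg d.adj.symm, ← Real.exp_sub, Real.log_exp]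
      have := (C.special k).adj.ne
      unfold CycleSystem.shift
      split_ifs <;> simp_all
    simp only [e] at this
    rw [← Int.cast_inj (α := ℝ), CycleSystem.walkShift, Int.cast_list_sum, List.map_map]
    simpa [Function.comp_def] using this
  · intro h
    funext N
    refine C.sum_darts_eq_zero (L := fun i j => Real.log (N.1.rate j i / N.1.rate i j)) ?_ w h
    intro i j
    rw [← Real.log_inv, inv_div]

/-! ### Generic positions. -/

/-- With a finite transcendence basis, `ℝ` would be algebraic over a countable ring and hence
countable. -/
theorem exists_algebraicIndependent_real (ι : Type*) [Finite ι] :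
    ∃ x : ι → ℝ, AlgebraicIndependent ℚ x := by
  obtain ⟨s, hs⟩ := exists_isTranscendenceBasis ℚ ℝ
  have hinf : s.Infinite := by
    intro hfin
    have : Finite s := hfin
    have := hs.isAlgebraic
    have h1 := Algebra.IsAlgebraic.cardinalMk_le_max
      (Algebra.adjoin ℚ (Set.range ((↑) : s → ℝ))) ℝ
    have h2 : Countable (MvPolynomial s ℚ) := by
      rw [← Cardinal.mk_le_aleph0_iff]
      refine MvPolynomial.cardinalMk_le_max.trans ?_
      simp
    have h3 : Countable (Algebra.adjoin ℚ (Set.range ((↑) : s → ℝ))) :=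
      hs.1.aevalEquiv.symm.injective.countable
    have h4 : Cardinal.mk ℝ ≤ Cardinal.aleph0 := h1.trans (max_le Cardinal.mk_le_aleph0 le_rfl)
    exact Cardinal.not_countable_real (Cardinal.le_aleph0_iff_set_countable.1 (by simpa using h4))
  have : Infinite s := hinf.to_subtype
  let e : ι ↪ s := ((Finite.equivFin ι).toEmbedding.trans Fin.valEmbedding).trans
    (Infinite.natEmbedding s)
  exact ⟨fun i => e i, hs.1.comp e e.injective⟩

/-- Positions with algebraically independent coordinates. -/
def GenericPosition {V : Type*} {n : ℕ} (p : V → Fin n → ℝ) : Prop :=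
  AlgebraicIndependent ℚ fun x : V × Fin n => p x.1 x.2

theorem exists_genericPosition (V : Type*) [Finite V] (n : ℕ) :
    ∃ p : V → Fin n → ℝ, GenericPosition p := by
  obtain ⟨x, hx⟩ := exists_algebraicIndependent_real (V × Fin n)
  exact ⟨fun v k => x (v, k), hx⟩

/-- The vector from `u` to the translate of `v` by `d`. -/
def displacement {V : Type*} {n : ℕ} (p : V → Fin n → ℝ) (u v : V) (d : Fin n → ℤ) (k : Fin n) :
    ℝ := p v k - p u k + d k

/-- A coordinate of the displacement as a polynomial in the positions. -/
noncomputable def displacementPoly {V : Type*} {n : ℕ} (u v : V) (d : Fin n → ℤ) (k : Fin n) :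
    MvPolynomial (V × Fin n) ℚ :=
  MvPolynomial.X (v, k) - MvPolynomial.X (u, k) + MvPolynomial.C (d k : ℚ)

/-- A minor of the matrix with rows `a`, `b`, `c`. -/
def minor {R : Type*} [CommRing R] {n : ℕ} (a b c : Fin n → R) (i j k : Fin n) : R :=
  a i * (b j * c k - b k * c j) - a j * (b i * c k - b k * c i) + a k * (b i * c j - b j * c i)

/-- The hypothesis is a linear dependence of the rows in which `c` has coefficient 1; a crossing of
two edges has this form. -/
theorem minor_eq_zero {n : ℕ} {a b c : Fin n → ℝ} {s t : ℝ} (h : ∀ k, s * a k = c k + t * b k)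
    (i j k : Fin n) : minor a b c i j k = 0 := by
  have h' : ∀ k, c k = s * a k - t * b k := fun k => by linarith [h k]
  unfold minor
  rw [h', h', h']
  ring

namespace GenericPosition

variable {V : Type*} {n : ℕ} {p : V → Fin n → ℝ}

/-- Reduces non-vanishing at generic positions to the exhibition of a single configuration `q` where
the polynomial does not vanish. -/
theorem aeval_ne_zero (hp : GenericPosition p) (P : MvPolynomial (V × Fin n) ℚ)
    (q : V → Fin n → ℝ) (hq : MvPolynomial.aeval (fun x : V × Fin n => q x.1 x.2) P ≠ 0) :
    MvPolynomial.aeval (fun x : V × Fin n => p x.1 x.2) P ≠ 0 := by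
  intro h
  have : P = 0 := (injective_iff_map_eq_zero _).1 hp P h
  exact hq (by rw [this, map_zero])

theorem aeval_displacementPoly (q : V → Fin n → ℝ) (u v : V) (d : Fin n → ℤ) (k : Fin n) :
    MvPolynomial.aeval (fun x : V × Fin n => q x.1 x.2) (displacementPoly u v d k) =
      displacement q u v d k := by
  simp [displacementPoly, displacement]

theorem cross_ne_zero (hp : GenericPosition p) {u v w z : V} (huv : u ≠ v) (hzu : z ≠ u)
    (hzv : z ≠ v) (hzw : z ≠ w) (d e : Fin n → ℤ) {k l : Fin n} (hkl : k ≠ l) :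
    displacement p u v d k * displacement p w z e l -
      displacement p u v d l * displacement p w z e k ≠ 0 := by
  classical
  have := hp.aeval_ne_zero (displacementPoly u v d k * displacementPoly w z e l -
    displacementPoly u v d l * displacementPoly w z e k)
  simp only [map_sub, map_mul, aeval_displacementPoly] at this
  -- Positions that turn the two displacements into the unit vectors `k` and `l`. The vertex `z` can
  -- be placed last since it differs from the other three.
  let q₀ : V → Fin n → ℝ := Function.update 0 v fun j => (if j = k then 1 else 0) - d j
  refine this (Function.update q₀ z fun j => q₀ w j + (if j = l then 1 else 0) - e j) ?_
  simp [displacement, q₀, Function.update_of_ne, huv, hzu.symm, hzv.symm, hzw.symm, hkl, hkl.symm]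
  intro h
  linarith

theorem cross_int_ne_zero (hp : GenericPosition p) {u v : V} (huv : u ≠ v) (d m : Fin n → ℤ)
    {k l : Fin n} (hkl : k ≠ l) (hm : m k ≠ 0) :
    displacement p u v d k * m l - displacement p u v d l * m k ≠ 0 := by
  classical
  have := hp.aeval_ne_zero (displacementPoly u v d k * MvPolynomial.C (m l : ℚ) -
    displacementPoly u v d l * MvPolynomial.C (m k : ℚ))
  simp only [map_sub, map_mul, aeval_displacementPoly, MvPolynomial.aeval_C] at this
  simp only [eq_ratCast, Rat.cast_intCast] at this
  refine this (Function.update 0 v fun j => (if j = l then 1 else 0) - d j) ?_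
  simp [displacement, Function.update_of_ne, huv, hkl, hm]

theorem minor_ne_zero (hp : GenericPosition p) {u v w z : V} (huv : u ≠ v) (hwu : w ≠ u)
    (hwv : w ≠ v) (hzu : z ≠ u) (hzv : z ≠ v) (hzw : z ≠ w) (d e m : Fin n → ℤ)
    {i j k : Fin n} (hij : i ≠ j) (hik : i ≠ k) (hjk : j ≠ k) :
    minor (displacement p u v d) (displacement p w z e) (displacement p u w m) i j k ≠ 0 := by
  classical
  have := hp.aeval_ne_zero (minor (displacementPoly u v d) (displacementPoly w z e)
    (displacementPoly u w m) i j k)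
  simp only [minor, map_add, map_sub, map_mul, aeval_displacementPoly] at this
  -- Positions that turn the three rows into the unit vectors `i`, `j` and `k`.
  let q₀ : V → Fin n → ℝ := Function.update (Function.update 0 v fun l => (if l = i then 1 else 0) - d l)
    w fun l => (if l = k then 1 else 0) - m l
  refine this (Function.update q₀ z fun l => q₀ w l + (if l = j then 1 else 0) - e l) ?_
  simp [displacement, q₀, Function.update_of_ne, huv, hzu.symm, hzv.symm, hzw.symm, hwu.symm,
    hwv.symm, hij, hik, hjk, hij.symm, hik.symm, hjk.symm]
  intro h
  linarith

theorem minor_int_ne_zero (hp : GenericPosition p) {u v z : V} (huv : u ≠ v)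
    (hzu : z ≠ u) (hzv : z ≠ v) (d e m : Fin n → ℤ)
    {i j k : Fin n} (hij : i ≠ j) (hik : i ≠ k) (hjk : j ≠ k) (hm : m k ≠ 0) :
    minor (displacement p u v d) (displacement p u z e) (fun l => (m l : ℝ)) i j k ≠ 0 := by
  classical
  have := hp.aeval_ne_zero (minor (displacementPoly u v d) (displacementPoly u z e)
    (fun l => MvPolynomial.C (m l : ℚ)) i j k)
  simp only [minor, map_add, map_sub, map_mul, aeval_displacementPoly, MvPolynomial.aeval_C] at this
  simp only [eq_ratCast, Rat.cast_intCast] at this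
  refine this (Function.update (Function.update 0 v fun l => (if l = i then 1 else 0) - d l) z
    fun l => (if l = j then 1 else 0) - e l) ?_
  simp [displacement, Function.update_of_ne, huv, hzu.symm, hzv.symm, hij,
    hij.symm, hik.symm, hjk.symm, hm]

end GenericPosition

theorem displacement_symm {V : Type*} {n : ℕ} (p : V → Fin n → ℝ) (u v : V) (d : Fin n → ℤ)
    (k : Fin n) : displacement p v u (fun j => - d j) k = - displacement p u v d k := by
  simp [displacement]
  ring

/-- Distinct edges share at most one vertex, so some end of the second lies off the first; reversing
the second edge if necessary, this end is `z`. -/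
theorem GenericPosition.cross_ne_zero_of_edge_ne {V : Type*} {n : ℕ} {p : V → Fin n → ℝ}
    (hp : GenericPosition p) {u v w z : V} (huv : u ≠ v) (hwz : w ≠ z) (hne : s(u, v) ≠ s(w, z))
    (d e : Fin n → ℤ) {k l : Fin n} (hkl : k ≠ l) :
    displacement p u v d k * displacement p w z e l -
      displacement p u v d l * displacement p w z e k ≠ 0 := by
  by_cases hz : z = u ∨ z = v
  · have hw : w ≠ u ∧ w ≠ v := by
      refine ⟨?_, ?_⟩ <;> rintro rfl <;> rcases hz with rfl | rfl <;> simp_all [Sym2.eq_swap]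
    have := hp.cross_ne_zero huv hw.1 hw.2 hwz d (fun j => - e j) hkl
    rw [displacement_symm, displacement_symm] at this
    intro h
    apply this
    linarith
  · push Not at hz
    exact hp.cross_ne_zero huv hz.1 hz.2 hwz.symm d e hkl

/-! ### Straight-line maps in generic position. -/

theorem exists_two_ne_of_three_le {n : ℕ} (hn : 3 ≤ n) (k : Fin n) :
    ∃ i j : Fin n, i ≠ j ∧ i ≠ k ∧ j ≠ k := by
  have h : 1 < (Finset.univ.erase k).card := by
    rw [Finset.card_erase_of_mem (Finset.mem_univ k), Finset.card_univ, Fintype.card_fin]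
    omega
  obtain ⟨i, hi, j, hj, hij⟩ := Finset.one_lt_card.1 h
  exact ⟨i, j, hij, Finset.ne_of_mem_erase hi, Finset.ne_of_mem_erase hj⟩

/-- Reversing edges makes a shared vertex the start of both, so only three relative positions of two
edges need to be treated. -/
theorem injective_of_edgePath {V : Type*} [DecidableEq V] {G : SimpleGraph V} {X : Type*}
    (hG : ∀ v, ∃ w, G.Adj v w) {f : realization G → X}
    (hsame : ∀ {u v : V} (h : G.Adj u v) (s t : I), f (edgePath h s) = f (edgePath h t) → s = t)
    (hshared : ∀ {u v z : V} (h : G.Adj u v) (h' : G.Adj u z) (s t : I), v ≠ z →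
      f (edgePath h s) = f (edgePath h' t) → s = 0 ∧ t = 0)
    (hdisj : ∀ {u v w z : V} (h : G.Adj u v) (h' : G.Adj w z) (s t : I), w ≠ u → w ≠ v →
      z ≠ u → z ≠ v → f (edgePath h s) ≠ f (edgePath h' t)) : Function.Injective f := by
  have key : ∀ {u v z : V} (h : G.Adj u v) (h' : G.Adj u z) (s t : I),
      f (edgePath h s) = f (edgePath h' t) → edgePath h s = edgePath h' t := by
    intro u v z h h' s t e
    by_cases hvz : v = z
    · subst hvz
      rw [hsame h s t e]
    · obtain ⟨rfl, rfl⟩ := hshared h h' s t hvz e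
      rw [(edgePath h).source, (edgePath h').source]
  intro x y hxy
  obtain ⟨u, v, h, s, rfl⟩ := exists_eq_edgePath hG x
  obtain ⟨w, z, h', t, rfl⟩ := exists_eq_edgePath hG y
  by_cases h1 : w = u
  · subst h1
    exact key h h' s t hxy
  by_cases h2 : w = v
  · subst h2
    rw [edgePath_symm h] at hxy ⊢
    exact key _ _ _ _ hxy
  by_cases h3 : z = u
  · subst h3
    rw [edgePath_symm h'] at hxy ⊢
    exact key _ _ _ _ hxy
  by_cases h4 : z = v
  · subst h4
    rw [edgePath_symm h, edgePath_symm h'] at hxy ⊢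
    exact key _ _ _ _ hxy
  exact absurd hxy (hdisj h h' s t h1 h2 h3 h4)

namespace CycleSystem

variable {V : Type*} [DecidableEq V] [Fintype V] {G : SimpleGraph V} {n : ℕ}

/-- Equality in the torus is a meeting of two segments in `ℝ^n` up to an integer translation `m`,
which is absorbed into the displacement from `u` to `w`. -/
theorem straightMap_eq_iff (C : CycleSystem G n) (p : V → Fin n → ℝ) {u v w z : V}
    (h : G.Adj u v) (h' : G.Adj w z) (s t : I) :
    C.straightMap p (edgePath h s) = C.straightMap p (edgePath h' t) ↔
      ∃ m : Fin n → ℤ, ∀ k, s * displacement p u v (C.shift u v) k =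
        displacement p u w m k + t * displacement p w z (C.shift w z) k := by
  rw [straightMap_edgePath, straightMap_edgePath, torusMk_eq_iff]
  refine exists_congr fun m => forall_congr' fun k => ?_
  unfold segmentLift displacement
  constructor <;> intro h <;> linarith

/-- A self-crossing makes `(s - t)` times the displacement an integer vector. A generic displacement
is parallel to no nonzero integer vector and is not zero, so `s = t`. -/
theorem eq_of_straightMap_eq (C : CycleSystem G n) (hn : 2 ≤ n) {p : V → Fin n → ℝ}
    (hp : GenericPosition p) {u v : V} (h : G.Adj u v) (s t : I)
    (e : C.straightMap p (edgePath h s) = C.straightMap p (edgePath h t)) : s = t := by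
  obtain ⟨m, hm⟩ := (C.straightMap_eq_iff p h h s t).1 e
  have hm' : ∀ k, ((s : ℝ) - t) * displacement p u v (C.shift u v) k = m k := by
    intro k
    have := hm k
    simp only [displacement, sub_self, zero_add] at this ⊢
    linarith
  have : Nontrivial (Fin n) := Fin.nontrivial_iff_two_le.2 hn
  by_cases hm0 : ∃ k, m k ≠ 0
  · obtain ⟨k, hk⟩ := hm0
    obtain ⟨l, hl⟩ := exists_ne k
    refine absurd ?_ (hp.cross_int_ne_zero h.ne (C.shift u v) m hl.symm hk)
    rw [← hm', ← hm']
    ring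
  · push Not at hm0
    have hk : ∃ k, displacement p u v (C.shift u v) k ≠ 0 := by
      by_contra hc
      push Not at hc
      obtain ⟨k, l, hkl⟩ := exists_pair_ne (Fin n)
      -- The zero vector would be parallel to `(1, ..., 1)`.
      refine hp.cross_int_ne_zero h.ne (C.shift u v) (fun _ => 1) hkl one_ne_zero ?_
      simp [hc]
    obtain ⟨k, hk⟩ := hk
    have := hm' k
    rw [hm0] at this
    apply Subtype.ext
    have := (mul_eq_zero.1 (this.trans Int.cast_zero)).resolve_right hk
    linarith

/-- Edges with a common vertex: a nonzero translation contradicts `minor_int_ne_zero`, and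
translation zero leaves only the common vertex because the edges are not parallel. Disjoint edges
are excluded by `minor_ne_zero`. -/
theorem straightMap_injective (C : CycleSystem G n) (hG : ∀ v, ∃ w, G.Adj v w) (hn : 3 ≤ n)
    {p : V → Fin n → ℝ} (hp : GenericPosition p) : Function.Injective (C.straightMap p) := by
  refine injective_of_edgePath hG (C.eq_of_straightMap_eq (by omega) hp) ?_ ?_
  · intro u v z h h' s t hvz e
    obtain ⟨m, hm⟩ := (C.straightMap_eq_iff p h h' s t).1 e
    have hm' : ∀ k, s * displacement p u v (C.shift u v) k =
        m k + t * displacement p u z (C.shift u z) k := by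
      intro k
      rw [hm k]
      simp [displacement]
    by_cases hm0 : ∃ k, m k ≠ 0
    · obtain ⟨k, hk⟩ := hm0
      obtain ⟨i, j, hij, hik, hjk⟩ := exists_two_ne_of_three_le hn k
      exact absurd (minor_eq_zero hm' i j k)
        (hp.minor_int_ne_zero h.ne h'.ne' hvz.symm _ _ m hij hik hjk hk)
    · push Not at hm0
      simp only [hm0, Int.cast_zero, zero_add] at hm'
      have hne : (⟨0, by omega⟩ : Fin n) ≠ ⟨1, by omega⟩ := by simp
      have hc := hp.cross_ne_zero h.ne h'.ne' hvz.symm h'.ne' (C.shift u v) (C.shift u z) hne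
      constructor
      · apply Subtype.ext
        refine (mul_eq_zero.1 ?_).resolve_right hc
        rw [mul_sub, ← mul_assoc, ← mul_assoc, hm', hm']
        ring
      · apply Subtype.ext
        refine (mul_eq_zero.1 ?_).resolve_right hc
        have a := hm' ⟨0, by omega⟩
        have b := hm' ⟨1, by omega⟩
        linear_combination displacement p u v (C.shift u v) ⟨1, by omega⟩ * a -
          displacement p u v (C.shift u v) ⟨0, by omega⟩ * b
  · intro u v w z h h' s t hwu hwv hzu hzv e
    obtain ⟨m, hm⟩ := (C.straightMap_eq_iff p h h' s t).1 e
    have hk : 0 < n := by omega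
    obtain ⟨i, j, hij, hik, hjk⟩ := exists_two_ne_of_three_le hn ⟨0, hk⟩
    exact hp.minor_ne_zero h.ne hwu hwv hzu hzv h'.ne' _ _ m hij hik hjk
      (minor_eq_zero hm i j _)

theorem isDrawing_straightMap (C : CycleSystem G n) (hG : ∀ v, ∃ w, G.Adj v w) (hn : n = 2)
    {p : V → Fin n → ℝ} (hp : GenericPosition p) : IsDrawing (C.straightMap p) := by
  subst hn
  have h01 : (0 : Fin 2) ≠ 1 := by simp
  refine ⟨?_, fun u v h s t => C.eq_of_straightMap_eq le_rfl hp h s t, ?_⟩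
  · intro v x hx
    have key : ∀ {z : V} (h : G.Adj v z) (s : I),
        C.straightMap p (edgePath h s) = C.straightMap p (vertexPt G v) →
        edgePath h s = vertexPt G v := by
      intro z h s e
      rw [C.eq_of_straightMap_eq le_rfl hp h s 0 (e.trans (congrArg _ (edgePath h).source.symm))]
      exact (edgePath h).source
    obtain ⟨w, z, h, s, rfl⟩ := exists_eq_edgePath hG x
    by_cases hw : w = v
    · subst hw
      exact key h s hx
    by_cases hz : z = v
    · subst hz
      rw [edgePath_symm h] at hx ⊢
      exact key _ _ hx
    exfalso
    rw [straightMap_vertexPt, straightMap_edgePath, torusMk_eq_iff] at hx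
    obtain ⟨m, hm⟩ := hx
    have hm' : ∀ k, displacement p w v m k = s * displacement p w z (C.shift w z) k := by
      intro k
      have := hm k
      simp only [displacement, segmentLift] at this ⊢
      linarith
    -- A vertex on a foreign edge would make the displacement from `w` to it parallel to that edge.
    refine hp.cross_ne_zero h.ne (Ne.symm hw) (Ne.symm hz) (Ne.symm hw) (C.shift w z) m h01 ?_
    rw [hm', hm']
    ring
  -- `B` bounds the integer translations at which two edges can meet; `S q m` collects the crossings
  -- of the pair of edges `q` with translation `m`.
  · let B : V → V → V → V → Fin 2 → ℝ := fun u v w z k =>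
      |displacement p u v (C.shift u v) k| + |displacement p w z (C.shift w z) k| +
        |p w k - p u k|
    let S : V × V × V × V → (Fin 2 → ℤ) → Set (realization G × realization G) := fun q m =>
      {x | ∃ (h : G.Adj q.1 q.2.1) (h' : G.Adj q.2.2.1 q.2.2.2) (s t : I),
        s(q.1, q.2.1) ≠ s(q.2.2.1, q.2.2.2) ∧ x = (edgePath h s, edgePath h' t) ∧
        ∀ k, s * displacement p q.1 q.2.1 (C.shift q.1 q.2.1) k =
          displacement p q.1 q.2.2.1 m k +
            t * displacement p q.2.2.1 q.2.2.2 (C.shift q.2.2.1 q.2.2.2) k}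
    have hS : ∀ q m, (S q m).Subsingleton := by
      rintro ⟨u, v, w, z⟩ m _ ⟨h, h', s, t, hne, rfl, hm⟩ _ ⟨-, -, s', t', -, rfl, hm'⟩
      simp only at h h' hne hm hm' ⊢
      -- The two parameters solve a linear 2 × 2 system with nonzero determinant.
      have hc := hp.cross_ne_zero_of_edge_ne h.ne h'.ne hne (C.shift u v) (C.shift w z) h01
      have a := hm 0
      have b := hm 1
      have a' := hm' 0
      have b' := hm' 1
      have hs : s = s' := by
        apply Subtype.ext
        refine sub_eq_zero.1 ((mul_eq_zero.1 ?_).resolve_right hc)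
        linear_combination displacement p w z (C.shift w z) 1 * (a - a') -
          displacement p w z (C.shift w z) 0 * (b - b')
      have ht : t = t' := by
        apply Subtype.ext
        refine sub_eq_zero.1 ((mul_eq_zero.1 ?_).resolve_right hc)
        linear_combination displacement p u v (C.shift u v) 1 * (a - a') -
          displacement p u v (C.shift u v) 0 * (b - b')
      rw [hs, ht]
    refine Set.Finite.subset (s := ⋃ q : V × V × V × V,
      ⋃ m ∈ Set.Icc (fun k => -⌈B q.1 q.2.1 q.2.2.1 q.2.2.2 k⌉)
        (fun k => ⌈B q.1 q.2.1 q.2.2.1 q.2.2.2 k⌉), S q m) ?_ ?_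
    · exact Set.finite_iUnion fun q => (Set.finite_Icc _ _).biUnion fun m _ => (hS q m).finite
    · rintro ⟨x, y⟩ ⟨hxy, e⟩
      simp only at hxy e
      obtain ⟨u, v, h, s, rfl⟩ := exists_eq_edgePath hG x
      obtain ⟨w, z, h', t, rfl⟩ := exists_eq_edgePath hG y
      obtain ⟨m, hm⟩ := (C.straightMap_eq_iff p h h' s t).1 e
      have hne : s(u, v) ≠ s(w, z) := by
        intro heq
        rcases Sym2.eq_iff.1 heq with ⟨rfl, rfl⟩ | ⟨rfl, rfl⟩
        · exact hxy (by rw [C.eq_of_straightMap_eq le_rfl hp h s t e])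
        · rw [edgePath_symm h'] at e hxy
          exact hxy (by rw [C.eq_of_straightMap_eq le_rfl hp h s _ e])
      have hb : ∀ k, |(m k : ℝ)| ≤ B u v w z k := by
        intro k
        have hs : |(s : ℝ) * displacement p u v (C.shift u v) k| ≤
            |displacement p u v (C.shift u v) k| := by
          rw [abs_mul, abs_of_nonneg s.2.1]
          exact mul_le_of_le_one_left (abs_nonneg _) s.2.2
        have ht : |(t : ℝ) * displacement p w z (C.shift w z) k| ≤
            |displacement p w z (C.shift w z) k| := by
          rw [abs_mul, abs_of_nonneg t.2.1]
          exact mul_le_of_le_one_left (abs_nonneg _) t.2.2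
        have : (m k : ℝ) = s * displacement p u v (C.shift u v) k -
            t * displacement p w z (C.shift w z) k - (p w k - p u k) := by
          have := hm k
          simp only [displacement] at this ⊢
          linarith
        rw [this]
        exact (abs_sub _ _).trans (add_le_add ((abs_sub _ _).trans (add_le_add hs ht)) le_rfl)
      simp only [Set.mem_iUnion]
      refine ⟨(u, v, w, z), m, ⟨fun k => ?_, fun k => ?_⟩, h, h', s, t, hne, rfl, hm⟩
      · have := (abs_le.1 (hb k)).1
        have h2 := Int.le_ceil (B u v w z k)
        have : (-⌈B u v w z k⌉ : ℝ) ≤ m k := by linarith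
        exact_mod_cast this
      · have := (abs_le.1 (hb k)).2
        have h2 := Int.le_ceil (B u v w z k)
        have : (m k : ℝ) ≤ ⌈B u v w z k⌉ := by linarith
        exact_mod_cast this

end CycleSystem

/-! ### Drawing a tree in a box. -/

namespace Rooting

variable {V : Type*} {T : SimpleGraph V} {r : V} (R : Rooting T r)

/-- `(v, s)` parametrizes the points of the tree uniquely: the half-open edge from the parent of `v`
to `v`, and the root as an extra point. -/
def ValidPoint (v : V) (s : ℝ) : Prop := 0 < s ∧ s ≤ 1 ∧ (v = r → s = 1)

/-- The point with parameters `(v, s)` of the straight-line drawing of the tree. -/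
def pointPos {n : ℕ} (p : V → Fin n → ℝ) (v : V) (s : ℝ) (k : Fin n) : ℝ :=
  (1 - s) * p (R.parent v) k + s * p v k

/-- The point with parameters `(v, s)` of the geometric realization of the tree. -/
def pointCoord [DecidableEq V] (v : V) (s : ℝ) (w : V) : ℝ :=
  (if w = R.parent v then 1 - s else 0) + if w = v then s else 0

/-- The straight-line drawing of the part `S` of the tree has no crossings. -/
def Drawn {n : ℕ} (p : V → Fin n → ℝ) (S : Set V) : Prop :=
  ∀ v ∈ S, ∀ w ∈ S, ∀ s t, ValidPoint (r := r) v s → ValidPoint (r := r) w t →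
    (∀ k, R.pointPos p v s k = R.pointPos p w t k) → v = w ∧ s = t

end Rooting

theorem int_eq_zero_of_mem_Icc {x y lo hi : ℝ} {m : ℤ} (h : x = y + m) (hx : lo ≤ x ∧ x ≤ hi)
    (hy : lo ≤ y ∧ y ≤ hi) (hw : hi < lo + 1) : m = 0 := by
  have h1 : (m : ℝ) < 1 := by linarith
  have h2 : (-1 : ℝ) < m := by linarith
  have h1' : m < 1 := by exact_mod_cast h1
  have h2' : -1 < m := by exact_mod_cast h2
  omega

/-- The point `x` lies in the gap between the box and its next translate, where no integer translate
of a point of the box can be. -/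
theorem false_of_mem_complement {x y lo hi : ℝ} {m : ℤ} (h : x = y + m)
    (hx : hi < x ∧ x < lo + 1) (hy : lo ≤ y ∧ y ≤ hi) : False := by
  have h1 : (m : ℝ) < 1 := by linarith
  have h2 : (0 : ℝ) < m := by linarith
  have h1' : m < 1 := by exact_mod_cast h1
  have h2' : 0 < m := by exact_mod_cast h2
  omega

theorem convex_combination_mem {x y lo hi s : ℝ} (h0 : 0 ≤ s) (h1 : s ≤ 1)
    (hx : lo ≤ x ∧ x ≤ hi) (hy : lo ≤ y ∧ y ≤ hi) :
    lo ≤ (1 - s) * x + s * y ∧ (1 - s) * x + s * y ≤ hi := by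
  constructor <;> nlinarith

namespace CycleSystem

variable {V : Type*} [DecidableEq V] {G : SimpleGraph V} {n : ℕ} {r : V}

theorem coe_edgePath_parent (C : CycleSystem G n) (R : Rooting C.tree r) {v : V} (hv : v ≠ r)
    (t : I) : (edgePath (C.tree_le (R.adj_parent v hv).symm) t : V → ℝ) = R.pointCoord v t := by
  funext w
  rw [edgePath_coe_apply]
  rfl

theorem coe_vertexPt (C : CycleSystem G n) (R : Rooting C.tree r) (v : V) :
    (vertexPt G v : V → ℝ) = R.pointCoord v 1 := by
  funext w
  simp [vertexPt, Rooting.pointCoord, Pi.single_apply]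

/-- The points over the vertex set `S` in the tree. -/
def treePart (C : CycleSystem G n) (R : Rooting C.tree r) (S : Set V) : Set (realization G) :=
  {x | ∃ v ∈ S, ∃ s, Rooting.ValidPoint (r := r) v s ∧ (x : V → ℝ) = R.pointCoord v s}

/-- The interiors of the edges outside the tree. -/
def specialPart (C : CycleSystem G n) : Set (realization G) :=
  {x | ∃ i, ∃ t : I, 0 < (t : ℝ) ∧ (t : ℝ) < 1 ∧ x = edgePath (C.special i).adj t}

theorem vertexPt_mem_treePart (C : CycleSystem G n) (R : Rooting C.tree r) {S : Set V} {v : V}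
    (hv : v ∈ S) : vertexPt G v ∈ C.treePart R S :=
  ⟨v, hv, 1, ⟨one_pos, le_rfl, fun _ => rfl⟩, C.coe_vertexPt R v⟩

theorem edgePath_parent_mem_treePart (C : CycleSystem G n) (R : Rooting C.tree r) {S : Set V}
    (hS : ∀ v ∈ S, R.parent v ∈ S) {v : V} (hv : v ≠ r) (hvS : v ∈ S) (t : I)
    (h : G.Adj (R.parent v) v) : edgePath h t ∈ C.treePart R S := by
  -- The start of an edge is not a valid point of that edge; it belongs to the parent, with
  -- parameter 1.
  by_cases ht : t = 0
  · subst ht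
    rw [(edgePath h).source]
    exact C.vertexPt_mem_treePart R (hS v hvS)
  · exact ⟨v, hvS, t, ⟨lt_of_le_of_ne t.2.1 fun h => ht (Subtype.ext h.symm), t.2.2,
      fun h => absurd h hv⟩, C.coe_edgePath_parent R hv t⟩

theorem edgePath_special_mem (C : CycleSystem G n) (R : Rooting C.tree r) {S : Set V}
    (hS : ∀ i, (C.special i).fst ∈ S ∧ (C.special i).snd ∈ S) (i : Fin n) (t : I) :
    edgePath (C.special i).adj t ∈ C.treePart R S ∪ C.specialPart := by
  by_cases h0 : t = 0
  · subst h0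
    rw [(edgePath (C.special i).adj).source]
    exact Or.inl (C.vertexPt_mem_treePart R (hS i).1)
  by_cases h1 : t = 1
  · subst h1
    rw [(edgePath (C.special i).adj).target]
    exact Or.inl (C.vertexPt_mem_treePart R (hS i).2)
  exact Or.inr ⟨i, t, lt_of_le_of_ne t.2.1 fun h => h0 (Subtype.ext h.symm),
    lt_of_le_of_ne t.2.2 fun h => h1 (Subtype.ext h), rfl⟩

/-- An edge whose tree edges lie over `S` is contained in the parts over `S`. -/
theorem edgePath_mem (C : CycleSystem G n) (R : Rooting C.tree r) {S : Set V}
    (hS : ∀ v ∈ S, R.parent v ∈ S) (hS' : ∀ i, (C.special i).fst ∈ S ∧ (C.special i).snd ∈ S)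
    {u v : V} (h : G.Adj u v) (huv : C.tree.Adj u v → u ∈ S ∧ v ∈ S) (t : I) :
    edgePath h t ∈ C.treePart R S ∪ C.specialPart := by
  rcases C.adj_cases h with ht | ⟨i, ⟨rfl, rfl⟩ | ⟨rfl, rfl⟩⟩
  · obtain ⟨hu, hv⟩ := huv ht
    rcases R.parent_of_adj _ _ ht with ⟨hr, rfl⟩ | ⟨hr, rfl⟩
    · rw [edgePath_symm]
      exact Or.inl (C.edgePath_parent_mem_treePart R hS hr hu _ _)
    · exact Or.inl (C.edgePath_parent_mem_treePart R hS hr hv _ _)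
  · exact C.edgePath_special_mem R hS' i t
  · rw [edgePath_symm]
    exact C.edgePath_special_mem R hS' i _

variable [Fintype V]

theorem straightMap_of_coe_eq (C : CycleSystem G n) (R : Rooting C.tree r) (p : V → Fin n → ℝ)
    {x : realization G} {v : V} {s : ℝ} (hs : Rooting.ValidPoint (r := r) v s)
    (hx : (x : V → ℝ) = R.pointCoord v s) :
    C.straightMap p x = torusMk (R.pointPos p v s) := by
  by_cases hv : v = r
  · obtain rfl := hs.2.2 hv
    rw [← C.coe_vertexPt R v] at hx
    rw [Subtype.ext hx, straightMap_vertexPt]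
    congr 1
    funext k
    simp [Rooting.pointPos]
  · have ht : s ∈ I := ⟨hs.1.le, hs.2.1⟩
    have := C.coe_edgePath_parent R hv ⟨s, ht⟩
    rw [Subtype.ext (hx.trans this.symm), straightMap_edgePath]
    congr 1
    funext k
    simp only [segmentLift, Rooting.pointPos, C.shift_of_tree (R.adj_parent v hv).symm]
    push_cast
    ring

/-- If the tree is drawn in a box without crossings, and every edge outside the tree connects
opposite sides of the box around the torus, then the drawing has no crossings. -/
theorem injOn_straightMap_of_box (C : CycleSystem G n) (R : Rooting C.tree r)
    {p : V → Fin n → ℝ} {S : Set V} (hS : ∀ v ∈ S, R.parent v ∈ S)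
    (hS' : ∀ i, (C.special i).fst ∈ S ∧ (C.special i).snd ∈ S)
    (hbox : ∀ v ∈ S, ∀ i, p (C.special i).snd i ≤ p v i ∧ p v i ≤ p (C.special i).fst i)
    (hwidth : ∀ i, p (C.special i).fst i < p (C.special i).snd i + 1) (hp : R.Drawn p S) :
    Set.InjOn (C.straightMap p) (C.treePart R S ∪ C.specialPart) := by
  have htree : ∀ v ∈ S, ∀ s, Rooting.ValidPoint (r := r) v s → ∀ i,
      p (C.special i).snd i ≤ R.pointPos p v s i ∧ R.pointPos p v s i ≤ p (C.special i).fst i :=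
    fun v hv s hs i => convex_combination_mem hs.1.le hs.2.1 (hbox _ (hS v hv) i) (hbox v hv i)
  -- In coordinate `i`, the interior of the `i`-th special edge stays in the gap; in the other
  -- coordinates (`hspec'`) the edge stays in the box.
  have hspec : ∀ i, ∀ t : I, 0 < (t : ℝ) → (t : ℝ) < 1 →
      p (C.special i).fst i < C.segmentLift p (C.special i).fst (C.special i).snd t i ∧
      C.segmentLift p (C.special i).fst (C.special i).snd t i < p (C.special i).snd i + 1 := by
    intro i t h0 h1
    have := hwidth i
    simp only [segmentLift, shift_special, if_true, Int.cast_one]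
    constructor <;> nlinarith
  have hspec' : ∀ i j, i ≠ j → ∀ t : I,
      p (C.special i).snd i ≤ C.segmentLift p (C.special j).fst (C.special j).snd t i ∧
      C.segmentLift p (C.special j).fst (C.special j).snd t i ≤ p (C.special i).fst i := by
    intro i j hij t
    have := convex_combination_mem t.2.1 t.2.2 (hbox _ (hS' j).1 i) (hbox _ (hS' j).2 i)
    simp only [segmentLift, shift_special, hij, if_false, Int.cast_zero]
    constructor <;> linarith
  have hmixed : ∀ v ∈ S, ∀ s, Rooting.ValidPoint (r := r) v s → ∀ i, ∀ t : I, 0 < (t : ℝ) →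
      (t : ℝ) < 1 → torusMk (C.segmentLift p (C.special i).fst (C.special i).snd t) ≠
        torusMk (R.pointPos p v s) := by
    intro v hv s hs i t h0 h1 e
    obtain ⟨m, hm⟩ := torusMk_eq_iff.1 e
    exact false_of_mem_complement (hm i) (hspec i t h0 h1) (htree v hv s hs i)
  rintro x hx y hy hxy
  rcases hx with ⟨v, hv, s, hs, hx⟩ | ⟨i, s, hs0, hs1, rfl⟩
  · rw [C.straightMap_of_coe_eq R p hs hx] at hxy
    rcases hy with ⟨w, hw, t, ht, hy⟩ | ⟨j, t, ht0, ht1, rfl⟩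
    · rw [C.straightMap_of_coe_eq R p ht hy, torusMk_eq_iff] at hxy
      obtain ⟨m, hm⟩ := hxy
      obtain ⟨rfl, rfl⟩ := hp v hv w hw s t hs ht fun k => by
        have := int_eq_zero_of_mem_Icc (hm k) (htree v hv s hs k) (htree w hw t ht k) (hwidth k)
        rw [hm k, this, Int.cast_zero, add_zero]
      exact Subtype.ext (hx.trans hy.symm)
    · rw [straightMap_edgePath] at hxy
      exact absurd hxy.symm (hmixed v hv s hs j t ht0 ht1)
  · rw [straightMap_edgePath] at hxy
    rcases hy with ⟨w, hw, t, ht, hy⟩ | ⟨j, t, ht0, ht1, rfl⟩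
    · rw [C.straightMap_of_coe_eq R p ht hy] at hxy
      exact absurd hxy (hmixed w hw t ht i s hs0 hs1)
    · rw [straightMap_edgePath] at hxy
      obtain ⟨m, hm⟩ := torusMk_eq_iff.1 hxy
      by_cases hij : i = j
      · subst hij
        have h1 := hspec i s hs0 hs1
        have h2 := hspec i t ht0 ht1
        have hb := (hbox _ (hS' i).2 i).2
        -- Both points lie in the open gap, whose length is at most 1.
        have hmi : m i = 0 := by
          have a1 : (m i : ℝ) < 1 := by linarith [hm i]
          have a2 : (-1 : ℝ) < m i := by linarith [hm i]
          have a1' : m i < 1 := by exact_mod_cast a1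
          have a2' : -1 < m i := by exact_mod_cast a2
          omega
        have e := hm i
        simp only [segmentLift, shift_special, if_true, Int.cast_one, hmi, Int.cast_zero] at e
        have hne : p (C.special i).snd i + 1 - p (C.special i).fst i ≠ 0 :=
          ne_of_gt (by linarith [hwidth i])
        have : s = t := Subtype.ext (mul_right_cancel₀ hne (by linarith))
        rw [this]
      · exact (false_of_mem_complement (hm i) (hspec i s hs0 hs1) (hspec' i j hij t)).elim

end CycleSystem

/-! ### Dimension one: embedding the cycle. -/

theorem mem_range_walkPath {V : Type*} [DecidableEq V] {G : SimpleGraph V} {u v : V}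
    (w : G.Walk u v) {x : realization G} (hx : x ∈ Set.range (walkPath w)) :
    x = vertexPt G v ∨ ∃ d ∈ w.darts, ∃ t : I, x = edgePath d.adj t := by
  induction w with
  | nil =>
    obtain ⟨t, rfl⟩ := hx
    exact Or.inl rfl
  | cons h w ih =>
    rw [walkPath, Path.trans_range] at hx
    rcases hx with ⟨t, rfl⟩ | hx
    · exact Or.inr ⟨⟨(_, _), h⟩, by simp, t, rfl⟩
    · rcases ih hx with hx | ⟨d, hd, t, rfl⟩
      · exact Or.inl hx
      · exact Or.inr ⟨d, by simp [hd], t, rfl⟩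

theorem mem_range_walkPath_of_isCycle {V : Type*} [DecidableEq V] {G : SimpleGraph V} {u : V}
    {w : G.Walk u u} (hw : w.IsCycle) {x : realization G} (hx : x ∈ Set.range (walkPath w)) :
    ∃ d ∈ w.darts, ∃ t : I, x = edgePath d.adj t := by
  rcases mem_range_walkPath w hx with rfl | h
  · cases w with
    | nil => exact absurd hw SimpleGraph.Walk.not_isCycle_nil
    | cons h w => exact ⟨⟨(_, _), h⟩, by simp, 0, (edgePath h).source.symm⟩
  · exact h

namespace CycleSystem

variable {V : Type*} {G : SimpleGraph V}

/-- If there is only one edge outside the tree, then the tree edges that are not on the path between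
its ends are bridges. -/
theorem isBridge_parent (C : CycleSystem G 1) (R : Rooting C.tree (C.special 0).snd) {v : V}
    (hv : ¬ R.Anc v (C.special 0).fst) : G.IsBridge s(v, R.parent v) := by
  have hr : v ≠ (C.special 0).snd := by
    rintro rfl
    exact hv (R.root_anc _)
  -- Only the edge above `v` leads out of the subtree below `v`: the one special edge joins the root
  -- to a vertex outside this subtree.
  have key : ∀ {x y : V} (q : G.Walk x y), R.Anc v x → ¬ R.Anc v y →
      s(v, R.parent v) ∈ q.edges := by
    intro x y q hx hy
    induction q with
    | nil => exact absurd hx hy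
    | cons h q ih =>
      rw [SimpleGraph.Walk.edges_cons, List.mem_cons]
      rcases C.adj_cases h with ht | ⟨i, hi⟩
      · rcases R.parent_of_adj _ _ ht with ⟨-, rfl⟩ | ⟨-, rfl⟩
        · rcases R.anc_cases hx with rfl | hx
          · exact Or.inl rfl
          · exact Or.inr (ih hx hy)
        · exact Or.inr (ih (hx.trans (R.anc_parent _)) hy)
      · obtain rfl : i = 0 := Subsingleton.elim _ _
        exfalso
        rcases hi with ⟨rfl, rfl⟩ | ⟨rfl, rfl⟩
        · exact hv hx
        · exact hr (R.anc_root_iff.1 hx)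
  rw [SimpleGraph.isBridge_iff_forall_walk_mem_edges]
  refine fun q => key q (R.anc_refl v) fun h => ?_
  have := R.depth_le_of_anc h
  have := R.depth_eq v hr
  omega

variable [DecidableEq V] [Fintype V]

/-- Rooted at one end of the special edge, the tree path to the other end `a` is placed on the line
by depth, and the special edge closes it up around the circle. A cycle contains no bridge, so its
tree edges lie on this path. -/
theorem exists_isEmbedding_on_cycles (C : CycleSystem G 1) :
    ∃ p : V → Fin 1 → ℝ, ∀ (u : V) (c : G.Walk u u), c.IsCycle →
      Topology.IsEmbedding ((Set.range (walkPath c)).domRestrict (C.straightMap p)) := by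
  obtain ⟨R⟩ := C.isTree.nonempty_rooting (C.special 0).snd
  set a := (C.special 0).fst with ha
  have hL : (0 : ℝ) < R.depth a + 1 := by positivity
  -- The denominator `R.depth a + 1` leaves a gap for the special edge.
  let p : V → Fin 1 → ℝ := fun v _ => R.depth v / (R.depth a + 1)
  let S : Set V := {v | R.Anc v a}
  have hS : ∀ v ∈ S, R.parent v ∈ S := fun v hv => (R.anc_parent v).trans hv
  have hS' : ∀ i, (C.special i).fst ∈ S ∧ (C.special i).snd ∈ S := by
    intro i
    obtain rfl : i = 0 := Subsingleton.elim _ _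
    exact ⟨R.anc_refl _, R.root_anc _⟩
  have hinj : Set.InjOn (C.straightMap p) (C.treePart R S ∪ C.specialPart) := by
    refine C.injOn_straightMap_of_box R hS hS' ?_ ?_ ?_
    · intro v hv i
      obtain rfl : i = 0 := Subsingleton.elim _ _
      have := R.depth_le_of_anc hv
      simp only [p, R.depth_root, Nat.cast_zero, zero_div]
      refine ⟨by positivity, ?_⟩
      gcongr
    · intro i
      obtain rfl : i = 0 := Subsingleton.elim _ _
      simp only [p, R.depth_root, Nat.cast_zero, zero_div, zero_add]
      rw [div_lt_one hL]
      linarith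
    -- After rescaling, the point `(v, s)` lies in the half-open unit interval that ends at the
    -- depth of `v`, so its position determines the depth, and the depth determines the ancestor of
    -- `a`.
    · have hpos : ∀ v s, Rooting.ValidPoint (r := (C.special 0).snd) v s →
          R.pointPos p v s 0 * (R.depth a + 1) = R.depth v - (1 - s) := by
        intro v s hs
        have e : R.pointPos p v s 0 * (R.depth a + 1) =
            (1 - s) * R.depth (R.parent v) + s * R.depth v := by
          simp only [Rooting.pointPos, p]
          field_simp
        rw [e]
        by_cases hv : v = (C.special 0).snd
        · rw [hs.2.2 hv]
          ring
        · rw [R.depth_eq v hv]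
          push_cast
          ring
      intro v hv w hw s t hs ht h
      have e : (R.depth v : ℝ) - (1 - s) = R.depth w - (1 - t) := by
        rw [← hpos v s hs, ← hpos w t ht, h 0]
      have hs' := hs.1
      have ht' := ht.1
      have hs'' := hs.2.1
      have ht'' := ht.2.1
      have h1 : (R.depth v : ℝ) < R.depth w + 1 := by linarith
      have h2 : (R.depth w : ℝ) < R.depth v + 1 := by linarith
      have h1' : R.depth v < R.depth w + 1 := by exact_mod_cast h1
      have h2' : R.depth w < R.depth v + 1 := by exact_mod_cast h2
      have hd : R.depth v = R.depth w := by omega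
      refine ⟨R.eq_of_anc_of_depth_eq hv hw hd, ?_⟩
      rw [hd] at e
      linarith
  refine ⟨p, fun u c hc => ?_⟩
  have hsub : Set.range (walkPath c) ⊆ C.treePart R S ∪ C.specialPart := by
    intro x hx
    obtain ⟨d, hd, t, rfl⟩ := mem_range_walkPath_of_isCycle hc hx
    refine C.edgePath_mem R hS hS' d.adj (fun ht => ?_) t
    have hmem : s(d.fst, d.snd) ∈ c.edges := List.mem_map.2 ⟨d, hd, rfl⟩
    have hanc : ∀ v, s(v, R.parent v) ∈ c.edges → R.Anc v a := by
      intro v hv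
      by_contra h
      exact (C.isBridge_parent R h).notMem_edges_of_isCycle hc hv
    rcases R.parent_of_adj _ _ ht with ⟨-, e⟩ | ⟨-, e⟩
    · have : d.fst ∈ S := hanc _ (e ▸ hmem)
      exact ⟨this, e ▸ hS _ this⟩
    · have : d.snd ∈ S := hanc _ (by rw [e, Sym2.eq_swap]; exact hmem)
      exact ⟨e ▸ hS _ this, this⟩
  have : CompactSpace (Set.range (walkPath c)) :=
    isCompact_iff_compactSpace.1 (isCompact_range (walkPath c).continuous)
  refine (Continuous.isClosedEmbedding ?_ ?_).isEmbedding
  · exact (C.straightMap p).continuous.comp continuous_subtype_val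
  · exact (hinj.mono hsub).injective

end CycleSystem

/-! ### Dimension two without disjoint cycles. -/

/-- A direction into the box that is parallel to none of the finitely many lines meets each of them
at most once. A segment shorter than all positive meeting parameters therefore avoids them, except
perhaps at its start `P`. -/
theorem exists_segment_avoiding {J : Type*} [Finite J] (A B : J → Fin 2 → ℝ) {lo hi : Fin 2 → ℝ}
    (hlt : ∀ k, lo k < hi k) {P : Fin 2 → ℝ} (hP : ∀ k, lo k ≤ P k ∧ P k ≤ hi k) :
    ∃ Q : Fin 2 → ℝ, (∀ k, lo k ≤ Q k ∧ Q k ≤ hi k) ∧ ∀ s, 0 < s → s ≤ 1 → ∀ j t,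
      ¬ ∀ k, (1 - s) * P k + s * Q k = (1 - t) * A j k + t * B j k := by
  obtain ⟨x, hx, hxP⟩ : ∃ x, (lo 0 ≤ x ∧ x ≤ hi 0) ∧ x - P 0 ≠ 0 := by
    by_cases h : P 0 = lo 0
    · exact ⟨hi 0, ⟨(hlt 0).le, le_rfl⟩, by rw [h]; exact sub_ne_zero.2 (hlt 0).ne'⟩
    · exact ⟨lo 0, ⟨le_rfl, (hlt 0).le⟩, sub_ne_zero.2 (Ne.symm h)⟩
  obtain ⟨y, hy, hyP⟩ : ∃ y ∈ Set.Icc (lo 1) (hi 1), ∀ j, B j ≠ A j →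
      (x - P 0) * (B j 1 - A j 1) - (y - P 1) * (B j 0 - A j 0) ≠ 0 := by
    have hbad : (⋃ j, {y : ℝ | B j ≠ A j ∧
        (x - P 0) * (B j 1 - A j 1) - (y - P 1) * (B j 0 - A j 0) = 0}).Finite := by
      refine Set.finite_iUnion fun j => Set.Subsingleton.finite ?_
      rintro y ⟨hne, hy⟩ y' ⟨-, hy'⟩
      by_cases h0 : B j 0 - A j 0 = 0
      · rw [h0, mul_zero, sub_zero] at hy
        have h1 := (mul_eq_zero.1 hy).resolve_left hxP
        refine absurd (funext fun k => ?_) hne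
        fin_cases k
        · exact sub_eq_zero.1 h0
        · exact sub_eq_zero.1 h1
      · refine mul_right_cancel₀ h0 ?_
        linarith
    obtain ⟨y, hy, hy'⟩ := (Set.Icc_infinite (hlt 1)).exists_notMem_finite hbad
    refine ⟨y, hy, fun j hj h => hy' (Set.mem_iUnion.2 ⟨j, hj, h⟩)⟩
  let D : Fin 2 → ℝ := ![x - P 0, y - P 1]
  have hD0 : D 0 = x - P 0 := rfl
  have hD1 : D 1 = y - P 1 := rfl
  have hfin : (⋃ j, {s : ℝ | ∃ t, ∀ k, P k + s * D k = (1 - t) * A j k + t * B j k}).Finite := by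
    refine Set.finite_iUnion fun j => Set.Subsingleton.finite ?_
    rintro s ⟨t, h⟩ s' ⟨t', h'⟩
    have a := h 0
    have b := h 1
    have a' := h' 0
    have b' := h' 1
    rw [hD0] at a a'
    rw [hD1] at b b'
    by_cases hne : B j = A j
    · rw [hne] at a a'
      refine mul_right_cancel₀ hxP ?_
      linarith
    · refine mul_right_cancel₀ (hyP j hne) ?_
      linear_combination (B j 1 - A j 1) * (a - a') - (B j 0 - A j 0) * (b - b')
  obtain ⟨δ, ⟨hδ, hδ1⟩, hδ0⟩ : ∃ δ : ℝ, ((∀ s ∈ ⋃ j, {s : ℝ | ∃ t, ∀ k,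
      P k + s * D k = (1 - t) * A j k + t * B j k}, 0 < s → δ < s) ∧ δ < 1) ∧ 0 < δ := by
    have h1 : ∀ᶠ δ : ℝ in nhdsWithin 0 (Set.Ioi 0), ∀ s ∈ ⋃ j, {s : ℝ | ∃ t, ∀ k,
        P k + s * D k = (1 - t) * A j k + t * B j k}, 0 < s → δ < s := by
      rw [Filter.eventually_all_finite hfin]
      intro s _
      by_cases hs : 0 < s
      · filter_upwards [Ioo_mem_nhdsGT hs] with δ hδ _ using hδ.2
      · exact Filter.Eventually.of_forall fun _ h => absurd h hs
    exact ((h1.and (Filter.Eventually.filter_mono nhdsWithin_le_nhds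
      (eventually_lt_nhds one_pos))).and self_mem_nhdsWithin).exists
  refine ⟨fun k => (1 - δ) * P k + δ * ![x, y] k, fun k => ?_, ?_⟩
  · refine convex_combination_mem hδ0.le hδ1.le (hP k) ?_
    fin_cases k
    · exact hx
    · exact hy
  · intro s hs0 hs1 j t h
    have := hδ (s * δ) (Set.mem_iUnion.2 ⟨j, t, fun k => ?_⟩) (mul_pos hs0 hδ0)
    · nlinarith
    · rw [← h k]
      fin_cases k
      · simp [D]; ring
      · simp [D]; ring

namespace Rooting

variable {V : Type*} {T : SimpleGraph V} {r : V} (R : Rooting T r)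

theorem Drawn.insert {R : Rooting T r} {n : ℕ} {p : V → Fin n → ℝ} {S : Set V}
    (h : R.Drawn p S) {v : V} (hv : v ≠ r) (hpar : R.parent v ∈ S)
    (hnew : ∀ s, 0 < s → s ≤ 1 → ∀ w ∈ S, ∀ t, ValidPoint (r := r) w t →
      ¬ ∀ k, R.pointPos p v s k = R.pointPos p w t k) : R.Drawn p (insert v S) := by
  -- Avoiding the endpoint of the parent's edge means that the new edge has nonzero length, so its
  -- parameter is determined.
  have hne : ∃ k, p v k ≠ p (R.parent v) k := by
    by_contra hc
    push Not at hc
    refine hnew 1 one_pos le_rfl _ hpar 1 ⟨one_pos, le_rfl, fun _ => rfl⟩ fun k => ?_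
    simp [pointPos, hc k]
  rintro x (rfl | hx) y (rfl | hy) s t hs ht e
  · refine ⟨rfl, ?_⟩
    obtain ⟨k, hk⟩ := hne
    have := e k
    simp only [pointPos] at this
    refine mul_right_cancel₀ (sub_ne_zero.2 hk) ?_
    linarith
  · exact absurd e (hnew s hs.1 hs.2.1 y hy t ht)
  · exact absurd (fun k => (e k).symm) (hnew t ht.1 ht.2.1 x hx s hs)
  · exact h x hx y hy s t hs ht e

theorem mem_of_anc {S : Set V} (hS : ∀ v ∈ S, R.parent v ∈ S) {w v : V} (h : R.Anc w v)
    (hv : v ∈ S) : w ∈ S := by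
  obtain ⟨k, rfl⟩ := h
  induction k generalizing v with
  | zero => exact hv
  | succ k ih => exact ih (hS v hv)

/-- A vertex set that is closed under parents can be exhausted by adding one vertex at a time. -/
theorem closed_induction [Finite V] {P : Set V → Prop} {A B : Set V} (hr : r ∈ A) (hAB : A ⊆ B)
    (hA : ∀ v ∈ A, R.parent v ∈ A) (hB : ∀ v ∈ B, R.parent v ∈ B) (h0 : P A)
    (hstep : ∀ S, A ⊆ S → (∀ v ∈ S, R.parent v ∈ S) → ∀ v ∈ B, v ∉ S → R.parent v ∈ S → P S →
      P (insert v S)) : P B := by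
  suffices h : ∀ k : ℕ, ∀ S, A ⊆ S → S ⊆ B → (∀ v ∈ S, R.parent v ∈ S) → P S →
      (B \ S).ncard = k → P B from h _ A subset_rfl hAB hA h0 rfl
  intro k
  induction k with
  | zero =>
    intro S _ hSB _ hP hk
    rw [Set.ncard_eq_zero, Set.sdiff_eq_empty] at hk
    rwa [← hSB.antisymm hk]
  | succ k ih =>
    intro S hAS hSB hS hP hk
    have hne : (B \ S).Nonempty := by
      rw [← Set.ncard_pos]
      omega
    -- A missing vertex of least depth has its parent in `S`.
    obtain ⟨v, ⟨hvB, hvS⟩, hmin⟩ := Set.exists_min_image (B \ S) R.depth (Set.toFinite _) hne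
    have hvr : v ≠ r := by
      rintro rfl
      exact hvS (hAS hr)
    have hpar : R.parent v ∈ S := by
      by_contra hc
      have := hmin _ ⟨hB v hvB, hc⟩
      have := R.depth_eq v hvr
      omega
    refine ih (insert v S) (hAS.trans (Set.subset_insert _ _)) (Set.insert_subset hvB hSB) ?_
      (hstep S hAS hS v hvB hvS hpar hP) ?_
    · rintro w (rfl | hw)
      · exact Or.inr hpar
      · exact Or.inr (hS w hw)
    · have : B \ insert v S = (B \ S) \ {v} := by
        ext w
        simp only [Set.mem_sdiff, Set.mem_insert_iff, Set.mem_singleton_iff]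
        tauto
      rw [this, Set.ncard_sdiff_singleton_of_mem (Set.mem_sdiff_of_mem hvB hvS), hk]
      rfl

/-- The number of common ancestors other than the root. -/
noncomputable def common (e v : V) : ℕ := {w | w ≠ r ∧ R.Anc w v ∧ R.Anc w e}.ncard

theorem common_eq [Finite V] (e : V) {v : V} (hv : v ≠ r) (h : R.Anc v e) :
    R.common e v = R.common e (R.parent v) + 1 := by
  unfold common
  rw [← Set.ncard_insert_of_notMem (a := v)]
  · congr 1
    ext w
    simp only [Set.mem_ofPred_eq, Set.mem_insert_iff]
    constructor
    · rintro ⟨h1, h2, h3⟩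
      rcases R.anc_cases h2 with h2 | h2
      · exact Or.inl h2
      · exact Or.inr ⟨h1, h2, h3⟩
    · rintro (rfl | ⟨h1, h2, h3⟩)
      · exact ⟨hv, R.anc_refl _, h⟩
      · exact ⟨h1, h2.trans (R.anc_parent v), h3⟩
  · rintro ⟨-, h2, -⟩
    have := R.depth_le_of_anc h2
    have := R.depth_eq v hv
    omega

theorem common_eq_zero {e e' u : V} (hee : ∀ w, R.Anc w e → R.Anc w e' → w = r)
    (hu : R.Anc u e) : R.common e' u = 0 := by
  unfold common
  have : {w | w ≠ r ∧ R.Anc w u ∧ R.Anc w e'} = ∅ := by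
    rw [Set.eq_empty_iff_forall_notMem]
    rintro w ⟨h1, h2, h3⟩
    exact h1 (hee w (h2.trans hu) h3)
  rw [this, Set.ncard_empty]

theorem common_le_self [Finite V] (e v : V) : R.common e v ≤ R.common e e :=
  Set.ncard_le_ncard (fun _ hw => ⟨hw.1, hw.2.2, hw.2.2⟩) (Set.toFinite _)

/-- A common ancestor of `w` and `e` lies in `S` and is comparable with `v`. As `v` is not in `S`,
it lies strictly above `v`. -/
theorem common_le_parent [Finite V] {S : Set V} (hS : ∀ v ∈ S, R.parent v ∈ S) {e v w : V}
    (hv : v ∉ S) (he : R.Anc v e) (hw : w ∈ S) : R.common e w ≤ R.common e (R.parent v) := by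
  refine Set.ncard_le_ncard ?_ (Set.toFinite _)
  rintro z ⟨h1, h2, h3⟩
  have hz : z ∈ S := R.mem_of_anc hS h2 hw
  refine ⟨h1, ?_, h3⟩
  rcases R.anc_total h3 he with h | h
  · rcases R.anc_cases h with rfl | h
    · exact absurd hz hv
    · exact h
  · exact absurd (R.mem_of_anc hS h hz) hv

/-- The signed number of common ancestors with `e` and with `e'`. -/
noncomputable def signedCommon (e e' v : V) : ℝ := (R.common e v : ℝ) - R.common e' v

theorem signedCommon_neg (e e' v : V) : R.signedCommon e e' v = - R.signedCommon e' e v := by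
  unfold signedCommon
  ring

theorem signedCommon_le [Finite V] {e e' : V} (hee : ∀ w, R.Anc w e → R.Anc w e' → w = r)
    (v : V) : R.signedCommon e e' v ≤ R.signedCommon e e' e := by
  unfold signedCommon
  rw [R.common_eq_zero hee (R.anc_refl e)]
  have : (R.common e v : ℝ) ≤ R.common e e := by exact_mod_cast R.common_le_self e v
  have : (0 : ℝ) ≤ R.common e' v := by positivity
  push_cast
  linarith

theorem signedCommon_lt [Finite V] {e e' : V} (hee : ∀ w, R.Anc w e → R.Anc w e' → w = r)
    (hne : e ≠ e') : R.signedCommon e e' e' < R.signedCommon e e' e := by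
  have h0 := R.common_eq_zero hee (R.anc_refl e)
  have h1 := R.common_eq_zero (fun w h h' => hee w h' h) (R.anc_refl e')
  have hpos : ∀ v, v ≠ r → 0 < R.common v v := by
    intro v hv
    rw [R.common_eq v hv (R.anc_refl v)]
    omega
  have : 0 < R.common e e + R.common e' e' := by
    by_cases he : e = r
    · have := hpos e' (fun h => hne (he.trans h.symm))
      omega
    · have := hpos e he
      omega
  have : (0 : ℝ) < R.common e e + R.common e' e' := by exact_mod_cast this
  unfold signedCommon
  rw [h0, h1]
  push_cast
  linarith

/-- On the branch towards `e` the count for `e'` vanishes. So a new vertex there goes one unit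
beyond its parent, which already attains the maximum over `S`. -/
theorem signedCommon_step [Finite V] {S : Set V} (hS : ∀ v ∈ S, R.parent v ∈ S) {e e' v w : V}
    (hee : ∀ w, R.Anc w e → R.Anc w e' → w = r) (hvr : v ≠ r) (hv : v ∉ S) (he : R.Anc v e)
    (hw : w ∈ S) : R.signedCommon e e' v = R.signedCommon e e' (R.parent v) + 1 ∧
      R.signedCommon e e' w ≤ R.signedCommon e e' (R.parent v) := by
  unfold signedCommon
  rw [R.common_eq e hvr he, R.common_eq_zero hee he,
    R.common_eq_zero hee ((R.anc_parent v).trans he)]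
  have : (R.common e w : ℝ) ≤ R.common e (R.parent v) := by
    exact_mod_cast R.common_le_parent hS hv he hw
  have : (0 : ℝ) ≤ R.common e' w := by positivity
  push_cast
  constructor <;> linarith

end Rooting

namespace Rooting

variable {V : Type*} {T : SimpleGraph V} {r : V} (R : Rooting T r)

/-- A new edge towards `E i` lies above everything drawn before in coordinate `i`, and one towards
`E' i` lies below, so it meets nothing old. -/
theorem drawn_signedCommon [Finite V] {n : ℕ} {E E' : Fin n → V}
    (hE : ∀ i w, R.Anc w (E i) → R.Anc w (E' i) → w = r) :
    R.Drawn (fun v i => R.signedCommon (E i) (E' i) v)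
      ({v | ∃ i, R.Anc v (E i) ∨ R.Anc v (E' i)} ∪ {r}) := by
  have hB : ∀ v ∈ {v | ∃ i, R.Anc v (E i) ∨ R.Anc v (E' i)} ∪ {r},
      R.parent v ∈ {v | ∃ i, R.Anc v (E i) ∨ R.Anc v (E' i)} ∪ {r} := by
    rintro v (⟨i, h | h⟩ | rfl)
    · exact Or.inl ⟨i, Or.inl ((R.anc_parent v).trans h)⟩
    · exact Or.inl ⟨i, Or.inr ((R.anc_parent v).trans h)⟩
    · exact Or.inr R.parent_root
  refine R.closed_induction (P := R.Drawn _) (A := {r}) rfl Set.subset_union_right ?_ hB ?_ ?_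
  · rintro v rfl
    exact R.parent_root
  · rintro v rfl w rfl s t hs ht -
    exact ⟨rfl, (hs.2.2 rfl).trans (ht.2.2 rfl).symm⟩
  · intro S hAS hS v hvB hvS hpar hP
    have hvr : v ≠ r := fun h => hvS (hAS h)
    refine hP.insert hvr hpar fun s hs0 hs1 w hw t ht heq => ?_
    rcases hvB with ⟨i, h | h⟩ | h
    · obtain ⟨h1, h2⟩ := R.signedCommon_step hS (hE i) hvr hvS h hw
      have h3 := (R.signedCommon_step hS (hE i) hvr hvS h (hS w hw)).2
      have := heq i
      simp only [pointPos, h1] at this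
      have ht0 := ht.1
      have ht1 := ht.2.1
      nlinarith
    · have hE' := fun w h h' => hE i w h' h
      obtain ⟨h1, h2⟩ := R.signedCommon_step hS hE' hvr hvS h hw
      have h3 := (R.signedCommon_step hS hE' hvr hvS h (hS w hw)).2
      have := heq i
      simp only [pointPos, R.signedCommon_neg (E i), h1] at this
      have ht0 := ht.1
      have ht1 := ht.2.1
      nlinarith
    · exact hvr h

theorem drawn_congr {n : ℕ} {p q : V → Fin n → ℝ} {S : Set V} (hS : ∀ v ∈ S, R.parent v ∈ S)
    (hpq : ∀ v ∈ S, p v = q v) (hp : R.Drawn p S) : R.Drawn q S := by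
  have : ∀ v ∈ S, ∀ s k, R.pointPos q v s k = R.pointPos p v s k := by
    intro v hv s k
    simp only [pointPos, hpq v hv, hpq _ (hS v hv)]
  intro v hv w hw s t hs ht h
  refine hp v hv w hw s t hs ht fun k => ?_
  rw [← this v hv, ← this w hw, h k]

/-- A tree can be drawn in a square without crossings, with two pairs of vertices on opposite sides,
if the root separates both pairs. -/
theorem exists_drawn_in_box [Finite V] {E E' : Fin 2 → V}
    (hE : ∀ i w, R.Anc w (E i) → R.Anc w (E' i) → w = r) (hne : ∀ i, E i ≠ E' i) :
    ∃ p : V → Fin 2 → ℝ, R.Drawn p Set.univ ∧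
      (∀ v i, p (E' i) i ≤ p v i ∧ p v i ≤ p (E i) i) ∧ ∀ i, p (E i) i < p (E' i) i + 1 := by
  classical
  let p₀ : V → Fin 2 → ℝ := fun v i => R.signedCommon (E i) (E' i) v
  let lo : Fin 2 → ℝ := fun i => p₀ (E' i) i
  let hi : Fin 2 → ℝ := fun i => p₀ (E i) i
  have hlt : ∀ i, lo i < hi i := fun i => R.signedCommon_lt (hE i) (hne i)
  have hbox : ∀ v i, lo i ≤ p₀ v i ∧ p₀ v i ≤ hi i := by
    refine fun v i => ⟨?_, R.signedCommon_le (hE i) v⟩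
    have := R.signedCommon_le (fun w h h' => hE i w h' h) v
    simp only [lo, p₀, R.signedCommon_neg (E i)]
    linarith
  let A : Set V := {v | ∃ i, R.Anc v (E i) ∨ R.Anc v (E' i)} ∪ {r}
  have hA : ∀ v ∈ A, R.parent v ∈ A := by
    rintro v (⟨i, h | h⟩ | rfl)
    · exact Or.inl ⟨i, Or.inl ((R.anc_parent v).trans h)⟩
    · exact Or.inl ⟨i, Or.inr ((R.anc_parent v).trans h)⟩
    · exact Or.inr R.parent_root
  -- The branches to the chosen vertices keep the positions `p₀`, which fix the sides of the box;
  -- all other vertices are attached by short segments inside it.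
  obtain ⟨p, hp, hpA, hpb⟩ : ∃ p : V → Fin 2 → ℝ, R.Drawn p Set.univ ∧ (∀ v ∈ A, p v = p₀ v) ∧
      ∀ v ∈ Set.univ, ∀ i, lo i ≤ p v i ∧ p v i ≤ hi i := by
    refine R.closed_induction (P := fun S => ∃ p : V → Fin 2 → ℝ, R.Drawn p S ∧
      (∀ v ∈ A, p v = p₀ v) ∧ ∀ v ∈ S, ∀ i, lo i ≤ p v i ∧ p v i ≤ hi i) (A := A)
      (Or.inr rfl) (Set.subset_univ _) hA (fun _ _ => trivial)
      ⟨p₀, R.drawn_signedCommon hE, fun _ _ => rfl, fun v _ => hbox v⟩ ?_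
    rintro S hAS hS v - hvS hpar ⟨p, hp, hpA, hpb⟩
    have hvr : v ≠ r := fun h => hvS (hAS (Or.inr h))
    obtain ⟨Q, hQ, hav⟩ := exists_segment_avoiding (fun w => p (R.parent w)) p hlt
      (hpb _ hpar)
    have hold : ∀ w ∈ S, p w = Function.update p v Q w := by
      intro w hw
      rw [Function.update_of_ne]
      rintro rfl
      exact hvS hw
    refine ⟨Function.update p v Q, (R.drawn_congr hS hold hp).insert hvr hpar ?_, ?_, ?_⟩
    · intro s hs0 hs1 w hw t ht heq
      refine hav s hs0 hs1 w t fun k => ?_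
      have := heq k
      simp only [pointPos, ← hold w hw, ← hold _ (hS w hw), ← hold _ hpar,
        Function.update_self] at this
      exact this
    · intro w hw
      rw [← hold w (hAS hw), hpA w hw]
    · rintro w (rfl | hw)
      · rw [Function.update_self]
        exact hQ
      · rw [← hold w hw]
        exact hpb w hw
  have hEA : ∀ i, E i ∈ A := fun i => Or.inl ⟨i, Or.inl (R.anc_refl _)⟩
  have hEA' : ∀ i, E' i ∈ A := fun i => Or.inl ⟨i, Or.inr (R.anc_refl _)⟩
  have hden : 0 < 1 + ∑ i, (hi i - lo i) :=
    add_pos_of_pos_of_nonneg one_pos (Finset.sum_nonneg fun i _ => sub_nonneg.2 (hlt i).le)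
  -- Scaling by this factor makes every side of the box shorter than 1.
  set ε : ℝ := (1 + ∑ i, (hi i - lo i))⁻¹ with hε
  have hε0 : 0 < ε := inv_pos.2 hden
  refine ⟨fun v i => ε * p v i, ?_, ?_, ?_⟩
  · intro v hv w hw s t hs ht h
    refine hp v hv w hw s t hs ht fun k => mul_left_cancel₀ hε0.ne' ?_
    have := h k
    simp only [pointPos] at this ⊢
    linarith
  · intro v i
    have := hpb v trivial i
    simp only [hpA _ (hEA i), hpA _ (hEA' i)]
    exact ⟨mul_le_mul_of_nonneg_left this.1 hε0.le, mul_le_mul_of_nonneg_left this.2 hε0.le⟩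
  · intro i
    simp only [hpA _ (hEA i), hpA _ (hEA' i)]
    have h1 : hi i - lo i ≤ ∑ i, (hi i - lo i) :=
      Finset.single_le_sum (f := fun i => hi i - lo i)
        (fun i _ => sub_nonneg.2 (hlt i).le) (Finset.mem_univ i)
    have h2 : ε * (hi i - lo i) < 1 := by
      rw [hε, inv_mul_lt_one₀ hden]
      linarith
    simp only [hi, lo] at h2
    linarith

end Rooting

namespace CycleSystem

variable {V : Type*} {G : SimpleGraph V} {n : ℕ}

theorem isCycle_closeUp (C : CycleSystem G n) (i : Fin n)
    {q : C.tree.Walk (C.special i).snd (C.special i).fst} (hq : q.IsPath) :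
    (C.closeUp i q).IsCycle := by
  unfold closeUp
  rw [SimpleGraph.Walk.cons_isCycle_iff]
  refine ⟨hq.mapLe C.tree_le, fun h => ?_⟩
  rw [SimpleGraph.Walk.edges_mapLe_eq_edges] at h
  exact C.special_edge_notMem i (q.edges_subset_edgeSet h)

/-- A common vertex of the two independent cycles lies on both tree paths, so as a root it separates
the ends of each special edge. -/
theorem exists_root (C : CycleSystem G 2) (hG : NoDisjointCycles G) :
    ∃ (r : V) (R : Rooting C.tree r), ∀ i w, R.Anc w (C.special i).fst →
      R.Anc w (C.special i).snd → w = r := by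
  choose q hq _ using fun i => C.isTree.existsUnique_path (C.special i).snd (C.special i).fst
  obtain ⟨r, h0, h1⟩ := hG _ _ _ _ (C.isCycle_closeUp 0 (hq 0)) (C.isCycle_closeUp 1 (hq 1))
  obtain ⟨R⟩ := C.isTree.nonempty_rooting r
  have hmem : ∀ i, r ∈ (C.closeUp i (q i)).support → r ∈ (q i).support := by
    intro i h
    unfold closeUp at h
    rw [SimpleGraph.Walk.support_cons, SimpleGraph.Walk.support_mapLe_eq_support,
      List.mem_cons] at h
    rcases h with rfl | h
    · exact (q i).end_mem_support
    · exact h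
  refine ⟨r, R, fun i w => R.eq_root_of_anc_of_anc (hq i) ?_⟩
  fin_cases i
  · exact hmem 0 h0
  · exact hmem 1 h1

theorem exists_injective_of_noDisjointCycles [DecidableEq V] [Fintype V] (C : CycleSystem G 2)
    (hG : NoDisjointCycles G) : ∃ p : V → Fin 2 → ℝ, Function.Injective (C.straightMap p) := by
  obtain ⟨r, R, hR⟩ := C.exists_root hG
  obtain ⟨p, hp, hbox, hwidth⟩ := R.exists_drawn_in_box hR fun i => (C.special i).adj.ne
  refine ⟨p, ?_⟩
  have := C.injOn_straightMap_of_box R (S := Set.univ) (fun _ _ => trivial)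
    (fun _ => ⟨trivial, trivial⟩) (fun v _ i => hbox v i) hwidth hp
  refine Set.injOn_univ.1 (this.mono fun x _ => ?_)
  rcases exists_eq_edgePath_or_vertexPt x with ⟨v, rfl⟩ | ⟨u, v, h, t, rfl⟩
  · exact Or.inl (C.vertexPt_mem_treePart R (S := Set.univ) trivial)
  · exact C.edgePath_mem R (S := Set.univ) (fun _ _ => trivial) (fun _ => ⟨trivial, trivial⟩) h
      (fun _ => ⟨trivial, trivial⟩) t

end CycleSystem

theorem isDrawing_of_injective {V : Type*} [DecidableEq V] {G : SimpleGraph V} {X : Type*}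
    {f : realization G → X} (hf : Function.Injective f) : IsDrawing f := by
  refine ⟨fun v x h => hf h, fun u v h s t e => edgePath_injective h (hf e), ?_⟩
  convert Set.finite_empty
  rw [Set.eq_empty_iff_forall_notMem]
  rintro ⟨x, y⟩ ⟨h1, h2⟩
  exact h1 (hf h2)

/-! ### Graphs that embed into the circle. -/

/-- By the intermediate value theorem both curves attain whichever of the two end values is nearer
to `e`. -/
theorem exists_eq_of_same_side {Γ₁ Γ₂ : C(I, ℝ)} {e : ℝ} (h₁ : Γ₁ 0 = e) (h₂ : Γ₂ 0 = e)
    (h : e < Γ₁ 1 ↔ e < Γ₂ 1) (hne₁ : Γ₁ 1 ≠ e) (hne₂ : Γ₂ 1 ≠ e) :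
    ∃ s t, Γ₁ s = Γ₂ t ∧ Γ₁ s ≠ e := by
  by_cases hlt : e < Γ₁ 1
  · have hlt' := h.1 hlt
    obtain ⟨s, hs⟩ := mem_range_of_exists_le_of_exists_ge Γ₁.continuous
      (c := min (Γ₁ 1) (Γ₂ 1)) ⟨0, by rw [h₁]; exact le_min hlt.le hlt'.le⟩ ⟨1, min_le_left _ _⟩
    obtain ⟨t, ht⟩ := mem_range_of_exists_le_of_exists_ge Γ₂.continuous
      (c := min (Γ₁ 1) (Γ₂ 1)) ⟨0, by rw [h₂]; exact le_min hlt.le hlt'.le⟩ ⟨1, min_le_right _ _⟩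
    exact ⟨s, t, hs.trans ht.symm, by rw [hs]; exact (lt_min hlt hlt').ne'⟩
  · have hlt₁ : Γ₁ 1 < e := lt_of_le_of_ne (not_lt.1 hlt) hne₁
    have hlt₂ : Γ₂ 1 < e := lt_of_le_of_ne (not_lt.1 fun h' => hlt (h.2 h')) hne₂
    obtain ⟨s, hs⟩ := mem_range_of_exists_le_of_exists_ge Γ₁.continuous
      (c := max (Γ₁ 1) (Γ₂ 1)) ⟨1, le_max_left _ _⟩ ⟨0, by rw [h₁]; exact max_le hlt₁.le hlt₂.le⟩
    obtain ⟨t, ht⟩ := mem_range_of_exists_le_of_exists_ge Γ₂.continuous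
      (c := max (Γ₁ 1) (Γ₂ 1)) ⟨1, le_max_right _ _⟩ ⟨0, by rw [h₂]; exact max_le hlt₁.le hlt₂.le⟩
    exact ⟨s, t, hs.trans ht.symm, by rw [hs]; exact (max_lt hlt₁ hlt₂).ne⟩

/-- A graph with a vertex of degree at least three does not embed into the circle. -/
theorem ncard_neighborSet_le_two {V : Type*} [Finite V] [DecidableEq V] {G : SimpleGraph V}
    {g : realization G → UnitAddCircle} (hg : Continuous g) (hinj : Function.Injective g) (v : V) :
    (G.neighborSet v).ncard ≤ 2 := by
  by_contra hlt
  rw [not_le, Set.two_lt_ncard_iff] at hlt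
  obtain ⟨a, b, c, ha, hb, hc, hab, hac, hbc⟩ := hlt
  have cov : IsCoveringMap ((↑) : ℝ → UnitAddCircle) := AddCircle.isCoveringMap_coe 1
  obtain ⟨e, he⟩ : ∃ e : ℝ, (e : UnitAddCircle) = g (vertexPt G v) :=
    QuotientAddGroup.mk_surjective _
  have lift : ∀ w, G.Adj v w → ∃ (h : G.Adj v w) (Γ : C(I, ℝ)), Γ 0 = e ∧ Γ 1 ≠ e ∧
      ∀ t, (Γ t : UnitAddCircle) = g (edgePath h t) := by
    intro w h
    obtain ⟨Γ, h1, h2⟩ := cov.exists_path_lifts ⟨fun t => g (edgePath h t), by fun_prop⟩ e (by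
      change g (edgePath h 0) = _
      rw [(edgePath h).source, he])
    have h3 : ∀ t, (Γ t : UnitAddCircle) = g (edgePath h t) := fun t => congrFun h1 t
    refine ⟨h, Γ, h2, fun h4 => ?_, h3⟩
    have := edgePath_injective h (hinj ((h3 1).symm.trans
      ((congrArg _ (h4.trans h2.symm)).trans (h3 0))))
    exact one_ne_zero this
  -- Lifts that leave to the same side share a value other than `e`, but the two edges share only
  -- the point `v`. The final contradiction is that three lifts have only two sides.
  have key : ∀ {w z : V} (h : G.Adj v w) (h' : G.Adj v z) (Γ Γ' : C(I, ℝ)), w ≠ z →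
      Γ 0 = e → Γ' 0 = e → Γ 1 ≠ e → Γ' 1 ≠ e →
      (∀ t, (Γ t : UnitAddCircle) = g (edgePath h t)) →
      (∀ t, (Γ' t : UnitAddCircle) = g (edgePath h' t)) → ¬ (e < Γ 1 ↔ e < Γ' 1) := by
    intro w z h h' Γ Γ' hwz h0 h0' h1 h1' hl hl' hside
    obtain ⟨s, t, hst, hs⟩ := exists_eq_of_same_side h0 h0' hside h1 h1'
    have : edgePath h s = edgePath h' t := hinj (by rw [← hl, ← hl', hst])
    have := congrFun (congrArg Subtype.val this) w
    rw [edgePath_coe_apply, edgePath_coe_apply] at this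
    simp only [h.ne', hwz, if_true, if_false, zero_add, add_zero] at this
    have hs0 : s = 0 := Subtype.ext this
    exact hs (hs0 ▸ h0)
  obtain ⟨ha, Γa, a0, a1, al⟩ := lift a ha
  obtain ⟨hb, Γb, b0, b1, bl⟩ := lift b hb
  obtain ⟨hc, Γc, c0, c1, cl⟩ := lift c hc
  have := key ha hb Γa Γb hab a0 b0 a1 b1 al bl
  have := key ha hc Γa Γc hac a0 c0 a1 c1 al cl
  have := key hb hc Γb Γc hbc b0 c0 b1 c1 bl cl
  tauto

/-- The degrees sum to `2 * |E| = 2 * |V|`, so no degree can be below the bound. -/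
theorem ncard_neighborSet_eq_two {V : Type*} [Fintype V] {G : SimpleGraph V}
    (hG : firstBetti G = 1) (h : ∀ v, (G.neighborSet v).ncard ≤ 2) (v : V) :
    (G.neighborSet v).ncard = 2 := by
  classical
  have hdeg : ∀ v, (G.neighborSet v).ncard = G.degree v := fun v => by
    rw [Set.ncard_eq_toFinset_card', ← SimpleGraph.card_neighborFinset_eq_degree]
    rfl
  simp only [hdeg] at h ⊢
  have hE : G.edgeFinset.card = Fintype.card V := by
    unfold firstBetti at hG
    rw [Set.ncard_eq_toFinset_card'] at hG
    have : (G.edgeSet.toFinset.card : ℤ) = Fintype.card V := by linarith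
    exact_mod_cast this
  have hsum : ∑ v, G.degree v = ∑ _v : V, 2 := by
    rw [SimpleGraph.sum_degrees_eq_twice_card_edges, hE]
    simp [mul_comm]
  exact (Finset.sum_eq_sum_iff_of_le fun v _ => h v).1 hsum v (Finset.mem_univ v)

/-! ### Existence of cycle systems and conclusion. -/

theorem MarkovChain.graph_connected {V : Type*} [Fintype V] [Nonempty V] (M : MarkovChain V) :
    M.graph.Connected := by
  refine ⟨fun i j => ?_⟩
  rw [SimpleGraph.reachable_iff_reflTransGen]
  exact M.irreducible i j

theorem SimpleGraph.Connected.nonempty_cycleSystem {V : Type*} [Fintype V] {G : SimpleGraph V}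
    (hG : G.Connected) {n : ℕ} (hn : firstBetti G = n) : Nonempty (CycleSystem G n) := by
  classical
  obtain ⟨T, hTG, hT⟩ := hG.exists_isTree_le
  have hcard : Nat.card ↥(G.edgeSet \ T.edgeSet) = n := by
    have h1 := hT.card_edgeFinset
    have h2 : T.edgeSet.ncard = T.edgeFinset.card := by
      rw [Set.ncard_eq_toFinset_card']
      rfl
    have h3 := Set.ncard_sdiff_add_ncard_of_subset (SimpleGraph.edgeSet_mono hTG)
    unfold firstBetti at hn
    rw [Nat.card_coe_set_eq]
    omega
  have e : Fin n ≃ ↥(G.edgeSet \ T.edgeSet) := (Finite.equivFinOfCardEq hcard).symm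
  have hd : ∀ x ∈ G.edgeSet, ∃ d : G.Dart, d.edge = x := by
    intro x hx
    induction x using Sym2.ind with
    | _ u v => exact ⟨⟨(u, v), hx⟩, rfl⟩
  choose d hd using hd
  refine ⟨⟨T, hTG, hT, fun i => d (e i) (e i).2.1, ?_⟩⟩
  simp only [hd]
  refine ⟨fun i _ => (e i).2, fun i _ j _ h => e.injective (Subtype.ext h), fun x hx => ?_⟩
  exact ⟨e.symm ⟨x, hx⟩, trivial, by simp⟩

theorem CycleSystem.exists_adj {V : Type*} {G : SimpleGraph V} {n : ℕ} (C : CycleSystem G n)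
    (hn : 0 < n) (v : V) : ∃ w, G.Adj v w := by
  have hd := (C.special ⟨0, hn⟩).adj.ne
  obtain ⟨w, hw⟩ : ∃ w, w ≠ v := by
    by_cases h : (C.special ⟨0, hn⟩).fst = v
    · exact ⟨_, fun h' => hd (h.trans h'.symm)⟩
    · exact ⟨_, h⟩
  obtain ⟨q⟩ := C.isTree.connected.preconnected v w
  cases q with
  | nil => exact absurd rfl hw
  | cons h _ => exact ⟨_, C.tree_le h⟩

/-- Suitable vertex positions in every dimension. -/
theorem CycleSystem.exists_positions {V : Type*} [Fintype V] [DecidableEq V] {G : SimpleGraph V}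
    {n : ℕ} (C : CycleSystem G n) : ∃ p : V → Fin n → ℝ,
      (3 ≤ n → Function.Injective (C.straightMap p)) ∧
      (n = 2 → NoDisjointCycles G → Function.Injective (C.straightMap p)) ∧
      (n = 2 → IsDrawing (C.straightMap p)) ∧
      (n = 1 → ∀ (u : V) (c : G.Walk u u), c.IsCycle →
        Topology.IsEmbedding ((Set.range (walkPath c)).domRestrict (C.straightMap p))) := by
  by_cases h1 : n = 1
  · subst h1
    obtain ⟨p, hp⟩ := C.exists_isEmbedding_on_cycles
    exact ⟨p, by omega, by omega, by omega, fun _ => hp⟩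
  by_cases h2 : n = 2 ∧ NoDisjointCycles G
  · obtain ⟨rfl, hG⟩ := h2
    obtain ⟨p, hp⟩ := C.exists_injective_of_noDisjointCycles hG
    exact ⟨p, by omega, fun _ _ => hp, fun _ => isDrawing_of_injective hp, by omega⟩
  obtain ⟨p, hp⟩ := exists_genericPosition V n
  exact ⟨p, fun h => C.straightMap_injective (C.exists_adj (by omega)) h hp,
    fun h h' => absurd ⟨h, h'⟩ h2,
    fun h => C.isDrawing_straightMap (C.exists_adj (by omega)) h hp, fun h => absurd h h1⟩

theorem mainTheorem4 {V : Type*} [Fintype V] [DecidableEq V] [Nonempty V] (M : MarkovChain V)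
    (n : ℕ) (hn : firstBetti M.graph = (n : ℤ)) :
    -- there are `n` independent cycles, and for any choice of them
    Nonempty (CycleSystem M.graph n) ∧
    (∀ C : CycleSystem M.graph n, ∃ f : C(realization M.graph, Torus n),
      -- zero potential gain is the same as being homotopy trivial in the torus
      (∀ (v : V) (w : M.graph.Walk v v),
        M.symbolicGain w = 0 ↔ HomotopyTrivial ((walkPath w).map f.continuous)) ∧
      -- the `i`-th independent cycle goes once around the `i`-th circle factor
      (∀ (i : Fin n) (p : C.tree.Walk (C.special i).snd (C.special i).fst), p.IsPath →
        Path.Homotopic ((walkPath (C.closeUp i p)).map f.continuous) (circleLoop _ i)) ∧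
      -- the map is an embedding of the chain, with the exceptions in low dimension
      (3 ≤ n → Topology.IsEmbedding f) ∧
      (n = 2 → NoDisjointCycles M.graph → Topology.IsEmbedding f) ∧
      (n = 2 → IsDrawing f) ∧
      (n = 1 → ∀ (u : V) (c : M.graph.Walk u u), c.IsCycle →
        Topology.IsEmbedding ((Set.range (walkPath c)).domRestrict f))) ∧
    -- for `n = 1` nothing but a cycle can be embedded
    (n = 1 → ∀ g : realization M.graph → Torus n, Topology.IsEmbedding g →
      ∀ v, (M.graph.neighborSet v).ncard = 2) := by
  refine ⟨M.graph_connected.nonempty_cycleSystem hn, fun C => ?_, ?_⟩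
  · obtain ⟨p, h3, h2, hdraw, h1⟩ := C.exists_positions
    -- The realization is compact and the torus is Hausdorff.
    have hemb : Function.Injective (C.straightMap p) → Topology.IsEmbedding (C.straightMap p) :=
      fun h => ((C.straightMap p).continuous.isClosedEmbedding h).isEmbedding
    exact ⟨C.straightMap p,
      fun v w => (M.symbolicGain_eq_zero_iff C w).trans (C.homotopyTrivial_iff p w).symm,
      fun i q _ => C.homotopic_circleLoop p i q, fun h => hemb (h3 h),
      fun h h' => hemb (h2 h h'), hdraw, h1⟩
  · rintro rfl g hg
    refine ncard_neighborSet_eq_two (by simpa using hn) fun v =>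
      ncard_neighborSet_le_two (g := fun x => g x 0) ?_ ?_ v
    · exact (continuous_apply 0).comp hg.continuous
    · intro x y hxy
      refine hg.injective (funext fun k => ?_)
      rw [Subsingleton.elim k 0]
      exact hxy
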